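/- Let $n\ge 1$ be an integer and $\alpha\in(0,1)$. Write points of $\mathbb{R}^{n+1}$ as $(x,t)$ with $x\in\mathbb{R}^n$, $t\in\mathbb{R}$. For an integer $m\ge 0$, let $C^{2m+\alpha,\frac{2m+\alpha}{2}}(\mathbb{T}^{n+1})$ be the set of functions $u:\mathbb{R}^{n+1}\to\mathbb{R}$ such that (i) for all integers $i,j\ge0$ with $i+2j\le 2m$ the derivatives $D_x^iD_t^ju$ exist and are continuous on $\mathbb{R}^{n+1}$, and for $i+2j=2m$ there is a constant $C$ with $$\left|D_x^iD_t^ju(x,t)-D_x^iD_t^ju(y,s)\right|\le C\left(|x-y|^2+|t-s|\right)^{\alpha/2}\quad\text{for all }(x,t),(y,s)\in\mathbb{R}^{n+1};$$ (ii) $u$ is periodic with period one in each of the variables $x_1,\dots,x_n,t$; (iii) $\int_{[0,1]^{n+1}}u(x,t)\,dx\,dt=0$. Then for every $h\in C^{\alpha,\frac{\alpha}{2}}(\mathbb{T}^{n+1})$ there exists exactly one $u\in C^{2+\alpha,\frac{2+\alpha}{2}}(\mathbb{T}^{n+1})$ such that $$u_t-\Delta_xu=h\quad\text{in }\mathbb{R}^{n+1}.$$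 -/

import Mathlib

open MeasureTheory

noncomputable section

/-- The parabolic distance `(|x - y|² + |t - s|)^{1/2}` between the points `X = (x, t)` and
`Y = (y, s)` of `ℝⁿ × ℝ`. -/
def parabolicDist {n : ℕ} (X Y : EuclideanSpace ℝ (Fin n) × ℝ) : ℝ :=
  Real.sqrt (‖X.1 - Y.1‖ ^ 2 + |X.2 - Y.2|)

/-- The time derivative `D_t^j u`. -/
def timeDeriv {n : ℕ} (j : ℕ) (u : EuclideanSpace ℝ (Fin n) × ℝ → ℝ)
    (X : EuclideanSpace ℝ (Fin n) × ℝ) : ℝ :=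
  iteratedDeriv j (fun s => u (X.1, s)) X.2

/-- The mixed derivative `D_x^i D_t^j u`, the tensor of all spatial partial derivatives of order
`i` of `D_t^j u`, viewed as an `i`-linear form on `ℝⁿ`. -/
def mixedDeriv {n : ℕ} (i j : ℕ) (u : EuclideanSpace ℝ (Fin n) × ℝ → ℝ)
    (X : EuclideanSpace ℝ (Fin n) × ℝ) :
    ContinuousMultilinearMap ℝ (fun _ : Fin i => EuclideanSpace ℝ (Fin n)) ℝ :=
  iteratedFDeriv ℝ i (fun y => timeDeriv j u (y, X.2)) X.1

/-- `u ∈ C^{2m, m}(ℝⁿ⁺¹)`: the derivatives `D_x^i D_t^j u` with `i + 2j ≤ 2m` exist and are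
continuous functions of `(x, t)`. The first two clauses say that the derivatives exist, so that no
default value of a derivative enters; the third is the joint continuity. -/
def IsParabolicC {n : ℕ} (m : ℕ) (u : EuclideanSpace ℝ (Fin n) × ℝ → ℝ) : Prop :=
  ∀ i j : ℕ, i + 2 * j ≤ 2 * m →
    (∀ x : EuclideanSpace ℝ (Fin n), ContDiff ℝ j (fun s : ℝ => u (x, s))) ∧
    (∀ t : ℝ, ContDiff ℝ i (fun y : EuclideanSpace ℝ (Fin n) => timeDeriv j u (y, t))) ∧
    Continuous (mixedDeriv i j u)

/-- `u ∈ C^{2m+α, (2m+α)/2}(ℝⁿ⁺¹)`: `u ∈ C^{2m, m}` and the derivatives `D_x^i D_t^j u` of top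
parabolic order `i + 2j = 2m` are Hölder continuous with exponent `α` for the parabolic
distance. -/
def IsParabolicHolder {n : ℕ} (m : ℕ) (α : ℝ) (u : EuclideanSpace ℝ (Fin n) × ℝ → ℝ) : Prop :=
  IsParabolicC m u ∧
    ∀ i j : ℕ, i + 2 * j = 2 * m →
      ∃ C : ℝ, ∀ X Y : EuclideanSpace ℝ (Fin n) × ℝ,
        ‖mixedDeriv i j u X - mixedDeriv i j u Y‖ ≤ C * parabolicDist X Y ^ α

/-- Period one in each of the coordinates `x₁, …, xₙ, t`. -/
def IsSpaceTimePeriodic {n : ℕ} (u : EuclideanSpace ℝ (Fin n) × ℝ → ℝ) : Prop :=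
  ∀ (x : EuclideanSpace ℝ (Fin n)) (t : ℝ) (k l : ℕ) (i : Fin n),
    u (x + (k : ℝ) • EuclideanSpace.single i (1 : ℝ), t - (l : ℝ)) = u (x, t)

/-- The closed unit cube `[0, 1]ⁿ⁺¹` of `ℝⁿ × ℝ`. -/
def unitCube (n : ℕ) : Set (EuclideanSpace ℝ (Fin n) × ℝ) :=
  {X | (∀ i : Fin n, X.1 i ∈ Set.Icc (0 : ℝ) 1) ∧ X.2 ∈ Set.Icc (0 : ℝ) 1}

/-- `u ∈ C^{2m+α, (2m+α)/2}(𝕋ⁿ⁺¹)`: `u` belongs to `C^{2m+α, (2m+α)/2}(ℝⁿ⁺¹)`, has zero average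
over the unit cube, and is periodic. -/
def IsTorusParabolicHolder {n : ℕ} (m : ℕ) (α : ℝ)
    (u : EuclideanSpace ℝ (Fin n) × ℝ → ℝ) : Prop :=
  IsParabolicHolder m α u ∧ (∫ X in unitCube n, u X) = 0 ∧ IsSpaceTimePeriodic u

end

/-!
# Classical solutions of the heat equation on the space-time torus

The solution is written down explicitly. Let `Z` be a standard Gaussian vector of `ℝⁿ` and let
`T_s f (x, t) = 𝔼 f (x + √(2s) Z, t - s)` (`heat`), the semigroup on functions of space-time
generated by `Δ - ∂ₜ`. For a source `f` all of whose spatial means vanish, the solution is the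
potential `U = ∫₀^∞ T_s f ds`. A general source is `f (x, t) + m t` with `m` its spatial mean; a
primitive of `m`, periodic because `h` has zero mean over space-time, takes care of the second
summand (`exists_solution`).

*Convergence and Hölder estimate in space.* By the Cameron–Martin formula the gradient of `T_s f`
is `(2s)^{-1/2} 𝔼 [⟪Z, ·⟫ f (x + √(2s) Z, t - s)]`, so it is bounded by `s^{-1/2} ‖f‖`, and by
`s^{(α-1)/2}` times the Hölder seminorm of `f`, since `Z` is centred. With the semigroup property
this bounds the Hessian by `s^{α/2-1}` and its Lipschitz constant by `s^{(α-3)/2}`. On periodic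
functions of zero mean the gradient bound also gives decay, as the torus is bounded: each step of
the flow gains `s^{-1/2}`, and three steps make the integral over large `s` converge
(`IsZeroMean.norm_heat_le_rpow`). Splitting the integral at `s = |x - y|²` yields the Hölder
estimate of `D²U` in space (`IsKernel.holder_space`).

*Regularity in time.* Duhamel's formula
`U (x, t + τ) = ∫₀^τ T_s f (x, t + τ) ds + 𝔼 U (x + √(2τ) Z, t)`
(`IsKernel.potential_eq_add_heat`), and its analogue for `D²U`, reduce time to space: it transfers
the Hölder estimate of `D²U` from space to time (`IsKernel.holder_time`), and, expanding the
Gaussian mean to second order, it shows that the right derivative of `U` in time is the continuous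
function `f + ΔU`, which is therefore the derivative (`hasDerivWithinAt_of_duhamel`,
`hasDerivAt_of_right`).

*Uniqueness* is the energy argument: a periodic solution `w` of the homogeneous equation satisfies
`∫ |∇w|² = -∫ w ∂ₜw = 0` over a period, hence is constant, hence zero (`eq_zero_of_heat_equation`).
-/

namespace TorusHeat

noncomputable section

open ProbabilityTheory Set Filter Topology
open scoped RealInnerProductSpace

/-! ### Standard Gaussian vectors -/

section Gaussian

variable {E : Type*} [NormedAddCommGroup E] [InnerProductSpace ℝ E] [FiniteDimensional ℝ E]
  [MeasurableSpace E] [BorelSpace E]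
variable {F : Type*} [NormedAddCommGroup F] [NormedSpace ℝ F]

lemma integrable_exp_mul_norm_stdGaussian (c : ℝ) :
    Integrable (fun z : E => Real.exp (c * ‖z‖)) (stdGaussian E) := by
  obtain ⟨C, hC, hint⟩ := IsGaussian.exists_integrable_exp_sq (stdGaussian E)
  refine (hint.const_mul (Real.exp (c ^ 2 / (4 * C)))).mono' (by fun_prop) (ae_of_all _ fun z => ?_)
  rw [Real.norm_eq_abs, abs_of_pos (Real.exp_pos _), ← Real.exp_add]
  apply Real.exp_le_exp.2
  have h : c ^ 2 / (4 * C) + C * ‖z‖ ^ 2 - c * ‖z‖ = (c - 2 * C * ‖z‖) ^ 2 / (4 * C) := by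
    field_simp
    ring
  have : 0 ≤ (c - 2 * C * ‖z‖) ^ 2 / (4 * C) := by positivity
  linarith

lemma integrable_norm_rpow_stdGaussian {p : ℝ} (hp : 0 ≤ p) :
    Integrable (fun z : E => ‖z‖ ^ p) (stdGaussian E) := by
  have := (IsGaussian.memLp_id (stdGaussian E) (ENNReal.ofReal p) (by simp)).integrable_norm_rpow'
  simpa [ENNReal.toReal_ofReal hp] using this

lemma integrable_norm_stdGaussian : Integrable (fun z : E => ‖z‖) (stdGaussian E) :=
  IsGaussian.integrable_id.norm

/-- The moment `E ‖Z‖ ^ p` of a standard Gaussian vector. -/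
def gaussMoment (E : Type*) [NormedAddCommGroup E] [InnerProductSpace ℝ E] [FiniteDimensional ℝ E]
    [MeasurableSpace E] (p : ℝ) : ℝ := ∫ z : E, ‖z‖ ^ p ∂stdGaussian E

lemma gaussMoment_nonneg (E : Type*) [NormedAddCommGroup E] [InnerProductSpace ℝ E]
    [FiniteDimensional ℝ E] [MeasurableSpace E] (p : ℝ) : 0 ≤ gaussMoment E p :=
  integral_nonneg fun z => by positivity

lemma stdGaussian_eq_withDensity :
    stdGaussian E = (volume : Measure E).withDensity (fun z => ENNReal.ofReal
      ((2 * Real.pi) ^ (-(Module.finrank ℝ E / 2 : ℝ)) * Real.exp (-‖z‖ ^ 2 / 2))) := by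
  set k : ℝ := (2 * Real.pi) ^ (-(Module.finrank ℝ E / 2 : ℝ)) with hk
  have hk0 : 0 < k := by positivity
  have hI : Integrable (fun z : E => k * Real.exp (-‖z‖ ^ 2 / 2)) := by
    refine Integrable.const_mul ?_ _
    have := (GaussianFourier.integrable_cexp_neg_mul_sq_norm_add (V := E)
      (b := (1 / 2 : ℂ)) (by norm_num) 0 0).norm
    refine this.congr (ae_of_all _ fun z => ?_)
    simp only [Complex.norm_exp]
    congr 1
    simp [← Complex.ofReal_pow]
    ring
  have : IsFiniteMeasure ((volume : Measure E).withDensity (fun z => ENNReal.ofReal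
      (k * Real.exp (-‖z‖ ^ 2 / 2)))) :=
    isFiniteMeasure_withDensity_ofReal hI.2
  apply Measure.ext_of_charFun
  ext t
  rw [charFun_stdGaussian, charFun_apply,
    integral_withDensity_eq_integral_toReal_smul (by fun_prop) (by simp)]
  have h := GaussianFourier.integral_cexp_neg_mul_sq_norm_add (V := E)
      (b := (1 / 2 : ℂ)) (by norm_num) Complex.I t
  have h2 : ∀ z : E, (ENNReal.ofReal (k * Real.exp (-‖z‖ ^ 2 / 2))).toReal •
      Complex.exp (⟪z, t⟫ * Complex.I) =
      (k : ℂ) * Complex.exp (-(1 / 2) * ‖z‖ ^ 2 + Complex.I * ⟪t, z⟫) := by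
    intro z
    rw [ENNReal.toReal_ofReal (by positivity), Complex.exp_add, Complex.real_smul]
    push_cast
    rw [real_inner_comm, mul_assoc]
    congr 3 <;> ring_nf
  simp_rw [h2]
  rw [integral_const_mul, h, hk, Complex.ofReal_cpow (by positivity), ← mul_assoc]
  push_cast
  rw [show (Real.pi : ℂ) / (1 / 2) = 2 * Real.pi by ring, ← Complex.cpow_add _ _ (by simp)]
  simp only [neg_add_cancel, Complex.cpow_zero, one_mul, Complex.I_sq]
  congr 1
  ring

/-- **Cameron–Martin**: translating a standard Gaussian vector by `v` multiplies its law by the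
density `exp (⟪v, z⟫ - ‖v‖² / 2)`. -/
lemma integral_stdGaussian_add (g : E → F) (v : E) :
    ∫ z, g (z + v) ∂stdGaussian E =
      ∫ z, Real.exp (⟪v, z⟫ - ‖v‖ ^ 2 / 2) • g z ∂stdGaussian E := by
  rw [stdGaussian_eq_withDensity,
    integral_withDensity_eq_integral_toReal_smul (by fun_prop) (by simp),
    integral_withDensity_eq_integral_toReal_smul (by fun_prop) (by simp)]
  conv_rhs => rw [← integral_add_right_eq_self _ v]
  congr 1
  ext z
  rw [smul_smul, ENNReal.toReal_ofReal (by positivity), ENNReal.toReal_ofReal (by positivity),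
    mul_assoc, ← Real.exp_add]
  congr 3
  rw [norm_add_sq_real, inner_add_right, real_inner_comm, real_inner_self_eq_norm_sq]
  ring

/-- The sum of two independent centred Gaussian vectors of variances `a²` and `b²` is a Gaussian
vector of variance `a² + b²`. -/
lemma integral_integral_stdGaussian {a b c : ℝ} (h : a ^ 2 + b ^ 2 = c ^ 2) {f : E → F}
    (hf : Continuous f) {M : ℝ} (hM : ∀ x, ‖f x‖ ≤ M) :
    ∫ z, ∫ w, f (a • z + b • w) ∂stdGaussian E ∂stdGaussian E =
      ∫ z, f (c • z) ∂stdGaussian E := by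
  have key : ((stdGaussian E).prod (stdGaussian E)).map (fun p : E × E => a • p.1 + b • p.2) =
      (stdGaussian E).map (fun z => c • z) := by
    have : IsProbabilityMeasure (((stdGaussian E).prod (stdGaussian E)).map
        (fun p : E × E => a • p.1 + b • p.2)) :=
      Measure.isProbabilityMeasure_map (by fun_prop)
    have : IsProbabilityMeasure ((stdGaussian E).map (fun z => c • z)) :=
      Measure.isProbabilityMeasure_map (by fun_prop)
    apply Measure.ext_of_charFun
    ext t
    rw [charFun_map_smul, charFun_apply, integral_map (by fun_prop) (by fun_prop)]
    have : ∀ p : E × E, Complex.exp (⟪a • p.1 + b • p.2, t⟫ * Complex.I) =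
        Complex.exp (⟪p.1, a • t⟫ * Complex.I) * Complex.exp (⟪p.2, b • t⟫ * Complex.I) := by
      intro p
      rw [← Complex.exp_add, inner_add_left, real_inner_smul_left, real_inner_smul_left,
        real_inner_smul_right, real_inner_smul_right]
      push_cast
      ring_nf
    simp_rw [this]
    rw [integral_prod_mul (fun z : E => Complex.exp (⟪z, a • t⟫ * Complex.I))
      (fun z : E => Complex.exp (⟪z, b • t⟫ * Complex.I)), ← charFun_apply, ← charFun_apply,
      charFun_stdGaussian, charFun_stdGaussian, charFun_stdGaussian, ← Complex.exp_add]
    congr 1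
    simp only [norm_smul, Real.norm_eq_abs, mul_pow, sq_abs, Complex.ofReal_mul,
      ← Complex.ofReal_pow, ← h]
    push_cast
    ring
  have hsm : AEStronglyMeasurable f ((stdGaussian E).map (fun z => c • z)) :=
    hf.aestronglyMeasurable
  rw [← integral_map (φ := fun z : E => c • z) (by fun_prop) hsm, ← key,
    integral_map (by fun_prop) hf.aestronglyMeasurable, integral_prod]
  have hg : Continuous fun p : E × E => f (a • p.1 + b • p.2) := by fun_prop
  exact Integrable.of_bound hg.aestronglyMeasurable M (ae_of_all _ fun p => hM _)

lemma integral_inner_mul_inner_stdGaussian (x y : E) :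
    ∫ z, ⟪x, z⟫ * ⟪y, z⟫ ∂stdGaussian E = ⟪x, y⟫ := by
  have h := covarianceBilin_apply (μ := stdGaussian E) IsGaussian.memLp_two_id x y
  rw [covarianceBilin_stdGaussian] at h
  have h0 : (∫ x, id x ∂stdGaussian E) = (0 : E) := integral_id_stdGaussian
  simp only [h0, sub_zero] at h
  exact h.symm

lemma integrable_inner_mul_inner_stdGaussian (x y : E) :
    Integrable (fun z => ⟪x, z⟫ * ⟪y, z⟫) (stdGaussian E) := by
  refine ((integrable_norm_rpow_stdGaussian (E := E) (p := 2) (by norm_num)).const_mul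
    (‖x‖ * ‖y‖)).mono' (by fun_prop) (ae_of_all _ fun z => ?_)
  rw [norm_mul]
  have h1 := norm_inner_le_norm (𝕜 := ℝ) x z
  have h2 := norm_inner_le_norm (𝕜 := ℝ) y z
  calc _ ≤ (‖x‖ * ‖z‖) * (‖y‖ * ‖z‖) := by gcongr
    _ = _ := by rw [Real.rpow_two]; ring

/-- The mean of a quadratic form on a standard Gaussian vector is its trace. -/
lemma integral_bilin_stdGaussian {ι : Type*} [Fintype ι] (b : OrthonormalBasis ι ℝ E)
    (B : E →L[ℝ] E →L[ℝ] ℝ) :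
    Integrable (fun z => B z z) (stdGaussian E) ∧
      ∫ z, B z z ∂stdGaussian E = ∑ i, B (b i) (b i) := by
  classical
  have h : ∀ z, B z z = ∑ i, ∑ j, B (b i) (b j) * (⟪b i, z⟫ * ⟪b j, z⟫) := by
    intro z
    conv_lhs => rw [← b.sum_repr' z]
    simp only [map_sum, map_smul, _root_.sum_apply, _root_.smul_apply,
      smul_eq_mul, Finset.mul_sum]
    rw [Finset.sum_comm]
    exact Finset.sum_congr rfl fun i _ => Finset.sum_congr rfl fun j _ => by ring
  have hi : ∀ i j, Integrable (fun z => B (b i) (b j) * (⟪b i, z⟫ * ⟪b j, z⟫)) (stdGaussian E) :=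
    fun i j => (integrable_inner_mul_inner_stdGaussian _ _).const_mul _
  simp_rw [h]
  refine ⟨integrable_finsetSum _ fun i _ => integrable_finsetSum _ fun j _ => hi i j, ?_⟩
  rw [integral_finsetSum _ fun i _ => integrable_finsetSum _ fun j _ => hi i j]
  refine Finset.sum_congr rfl fun i _ => ?_
  rw [integral_finsetSum _ fun j _ => hi i j]
  simp_rw [integral_const_mul, integral_inner_mul_inner_stdGaussian, b.inner_eq_ite]
  simp

end Gaussian

/-! ### The space-time heat semigroup -/

section Kernel

variable {E : Type*} [NormedAddCommGroup E] [InnerProductSpace ℝ E]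
variable {F : Type*} [NormedAddCommGroup F]

lemma continuous_gaussKernel {f : E × ℝ → F} (X : E × ℝ) (s : ℝ) (hf : Continuous f) :
    Continuous fun z : E => f (X.1 + √(2 * s) • z, X.2 - s) := by fun_prop

lemma integrable_gaussKernel [FiniteDimensional ℝ E] [MeasurableSpace E] [BorelSpace E]
    {f : E × ℝ → F} {M : ℝ} (hf : Continuous f) (hM : ∀ X, ‖f X‖ ≤ M) (X : E × ℝ) (s : ℝ) :
    Integrable (fun z : E => f (X.1 + √(2 * s) • z, X.2 - s)) (stdGaussian E) :=
  Integrable.of_bound (continuous_gaussKernel X s hf).aestronglyMeasurable M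
    (ae_of_all _ fun _ => hM _)

variable [NormedSpace ℝ F]

lemma norm_smulRight_inner (z : E) (c : F) :
    ‖(innerSL ℝ z).smulRight c‖ = ‖z‖ * ‖c‖ := by
  rw [ContinuousLinearMap.norm_smulRight_apply, innerSL_apply_norm]

lemma continuous_smulRight_inner {T : Type*} [TopologicalSpace T] {a : T → E} {g : T → F}
    (ha : Continuous a) (hg : Continuous g) :
    Continuous fun z => (innerSL ℝ (a z)).smulRight (g z) := by
  have h := (ContinuousLinearMap.smulRightL ℝ E F).continuous₂
  have h2 : Continuous fun z => (innerSL ℝ (a z), g z) := by fun_prop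
  exact h.comp h2

end Kernel

section Semigroup

variable {E : Type*} [NormedAddCommGroup E] [InnerProductSpace ℝ E] [FiniteDimensional ℝ E]
  [MeasurableSpace E]
variable {F : Type*} [NormedAddCommGroup F] [NormedSpace ℝ F]

/-- The space-time heat semigroup `T_s f (x, t) = 𝔼 f (x + √(2s) Z, t - s)`, `Z` a standard Gaussian
vector: the heat flow for time `s` in `x` combined with the shift by `s` in `t`. Its generator is
`Δ - ∂ₜ`. -/
def heat (s : ℝ) (f : E × ℝ → F) (X : E × ℝ) : F :=
  ∫ z, f (X.1 + √(2 * s) • z, X.2 - s) ∂stdGaussian E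

/-- The spatial gradient of `heat s f`, written as
`(2s)^{-1/2} 𝔼 [⟪Z, ·⟫ f (x + √(2s) Z, t - s)]`, which makes sense for merely continuous `f`. -/
def heatGrad (s : ℝ) (f : E × ℝ → F) (X : E × ℝ) : E →L[ℝ] F :=
  (√(2 * s))⁻¹ • ∫ z, (innerSL ℝ z).smulRight (f (X.1 + √(2 * s) • z, X.2 - s)) ∂stdGaussian E

/-- The spatial Hessian of `heat s f`, each of the two derivatives acting on one half of the
flow. -/
def heatHess (s : ℝ) (f : E × ℝ → F) : E × ℝ → E →L[ℝ] E →L[ℝ] F :=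
  heatGrad (s / 2) (heatGrad (s / 2) f)

variable [BorelSpace E] {f : E × ℝ → F} {M : ℝ}

lemma integrable_smulRight_inner {g : E → F} (hg : Continuous g) (hM : ∀ z, ‖g z‖ ≤ M) :
    Integrable (fun z : E => (innerSL ℝ z).smulRight (g z)) (stdGaussian E) := by
  refine (integrable_norm_stdGaussian.mul_const M).mono'
    (continuous_smulRight_inner continuous_id hg).aestronglyMeasurable
    (ae_of_all _ fun z => ?_)
  rw [norm_smulRight_inner]
  exact mul_le_mul_of_nonneg_left (hM z) (norm_nonneg z)

lemma continuous_heat (hf : Continuous f) (hM : ∀ X, ‖f X‖ ≤ M) (s : ℝ) :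
    Continuous (heat s f) := by
  refine continuous_of_dominated (bound := fun _ => M)
    (fun X => (continuous_gaussKernel X s hf).aestronglyMeasurable)
    (fun X => ae_of_all _ fun _ => hM _) (integrable_const _) (ae_of_all _ fun z => ?_)
  fun_prop

lemma norm_heat_le (hM : ∀ X, ‖f X‖ ≤ M) (s : ℝ) (X : E × ℝ) : ‖heat s f X‖ ≤ M := by
  simpa [heat] using norm_integral_le_of_norm_le_const (μ := stdGaussian E)
    (f := fun z => f (X.1 + √(2 * s) • z, X.2 - s)) (ae_of_all _ fun _ => hM _)

lemma continuous_heatGrad (hf : Continuous f) (hM : ∀ X, ‖f X‖ ≤ M) (s : ℝ) :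
    Continuous (heatGrad s f) := by
  refine Continuous.const_smul (c := (√(2 * s))⁻¹) ?_
  refine continuous_of_dominated (bound := fun z => ‖z‖ * M)
    (fun X => (continuous_smulRight_inner continuous_id
      (continuous_gaussKernel X s hf)).aestronglyMeasurable)
    (fun X => ae_of_all _ fun z => ?_) (integrable_norm_stdGaussian.mul_const M)
    (ae_of_all _ fun z => continuous_smulRight_inner continuous_const (by fun_prop))
  rw [norm_smulRight_inner]
  exact mul_le_mul_of_nonneg_left (hM _) (norm_nonneg z)

lemma norm_heatGrad_le (hM : ∀ X, ‖f X‖ ≤ M) (s : ℝ) (X : E × ℝ) :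
    ‖heatGrad s f X‖ ≤ (√(2 * s))⁻¹ * (gaussMoment E 1 * M) := by
  rw [heatGrad, norm_smul, norm_inv, Real.norm_of_nonneg (Real.sqrt_nonneg _)]
  refine mul_le_mul_of_nonneg_left ?_ (by positivity)
  simp only [gaussMoment, Real.rpow_one]
  rw [← integral_mul_const]
  refine norm_integral_le_of_norm_le (integrable_norm_stdGaussian.mul_const M)
    (ae_of_all _ fun z => ?_)
  rw [norm_smulRight_inner]
  exact mul_le_mul_of_nonneg_left (hM _) (norm_nonneg z)

lemma integral_smulRight_inner_const [CompleteSpace F] (c : F) :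
    ∫ z, (innerSL ℝ z).smulRight c ∂stdGaussian E = 0 := by
  have h := (((ContinuousLinearMap.smulRightL ℝ E F).flip c).comp
    (innerSL ℝ (E := E))).integral_comp_comm
    (IsGaussian.integrable_id (μ := stdGaussian E))
  have h0 : (∫ x, id x ∂stdGaussian E) = (0 : E) := integral_id_stdGaussian
  rw [h0, map_zero] at h
  exact h

/-- The gain from Hölder continuity: as `Z` is centred, `f` may be replaced by its oscillation. -/
lemma norm_heatGrad_le_of_holder [CompleteSpace F] (hf : Continuous f) (hM : ∀ X, ‖f X‖ ≤ M)
    {α H : ℝ} (hα : 0 ≤ α) (hH : ∀ x y t, ‖f (x, t) - f (y, t)‖ ≤ H * ‖x - y‖ ^ α)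
    (s : ℝ) (X : E × ℝ) :
    ‖heatGrad s f X‖ ≤ (√(2 * s))⁻¹ * (gaussMoment E (1 + α) * (H * √(2 * s) ^ α)) := by
  have h : heatGrad s f X = (√(2 * s))⁻¹ • ∫ z, (innerSL ℝ z).smulRight
      (f (X.1 + √(2 * s) • z, X.2 - s) - f (X.1, X.2 - s)) ∂stdGaussian E := by
    rw [heatGrad, ← sub_zero (∫ z, _ ∂stdGaussian E),
      ← integral_smulRight_inner_const (f (X.1, X.2 - s)), ← integral_sub
      (integrable_smulRight_inner (continuous_gaussKernel X s hf) (M := M) fun _ => hM _)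
      (integrable_smulRight_inner continuous_const (M := M) fun _ => hM _)]
    congr 2
    ext z v
    simp [smul_sub]
  rw [h, norm_smul, norm_inv, Real.norm_of_nonneg (Real.sqrt_nonneg _)]
  refine mul_le_mul_of_nonneg_left ?_ (by positivity)
  rw [gaussMoment, ← integral_mul_const]
  refine norm_integral_le_of_norm_le
    ((integrable_norm_rpow_stdGaussian (by positivity)).mul_const _) (ae_of_all _ fun z => ?_)
  rw [norm_smulRight_inner, Real.rpow_add_of_nonneg (norm_nonneg z) zero_le_one hα,
    Real.rpow_one, mul_assoc]
  refine mul_le_mul_of_nonneg_left ((hH _ _ _).trans_eq ?_) (norm_nonneg z)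
  rw [add_sub_cancel_left, norm_smul, Real.norm_of_nonneg (Real.sqrt_nonneg _),
    Real.mul_rpow (Real.sqrt_nonneg _) (norm_nonneg z)]
  ring

lemma heat_comp_add (s : ℝ) (f : E × ℝ → F) (x v : E) (t : ℝ) :
    heat s f (x + √(2 * s) • v, t) = ∫ z, Real.exp (⟪v, z⟫ - ‖v‖ ^ 2 / 2) •
      f (x + √(2 * s) • z, t - s) ∂stdGaussian E := by
  rw [← integral_stdGaussian_add (fun z => f (x + √(2 * s) • z, t - s)) v, heat]
  congr 1
  ext z
  simp only [smul_add]
  congr 2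
  abel

/-- The heat flow of a bounded continuous function is differentiable in space, with derivative
`heatGrad`: the derivative falls on the Cameron–Martin density. -/
lemma hasFDerivAt_heat {s : ℝ} (hs : 0 < s) (hf : Continuous f) (hM : ∀ X, ‖f X‖ ≤ M)
    (x : E) (t : ℝ) :
    HasFDerivAt (fun y => heat s f (y, t)) (heatGrad s f (x, t)) x := by
  have hM0 : 0 ≤ M := (norm_nonneg _).trans (hM (0, 0))
  have ha : 0 < √(2 * s) := by positivity
  set a := √(2 * s) with ha_def
  let g : E → F := fun z => f (x + a • z, t - s)
  have hg : Continuous g := by fun_prop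
  let w : E → E → ℝ := fun v z => Real.exp (⟪v, z⟫ - ‖v‖ ^ 2 / 2)
  have hw_le : ∀ v ∈ Metric.ball (0 : E) 1, ∀ z, w v z ≤ Real.exp ‖z‖ := by
    intro v hv z
    rw [mem_ball_zero_iff] at hv
    apply Real.exp_le_exp.2
    have := real_inner_le_norm v z
    nlinarith [norm_nonneg z, sq_nonneg ‖v‖]
  have hG : HasFDerivAt (fun v => ∫ z, w v z • g z ∂stdGaussian E)
      (∫ z, (innerSL ℝ z).smulRight (g z) ∂stdGaussian E) 0 := by
    have key := hasFDerivAt_integral_of_dominated_of_fderiv_le (𝕜 := ℝ) (μ := stdGaussian E)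
      (F := fun v z => w v z • g z) (x₀ := (0 : E)) (s := Metric.ball 0 1)
      (F' := fun v z => (w v z • (innerSL ℝ (z - v))).smulRight (g z))
      (bound := fun z => M * Real.exp (2 * ‖z‖)) (Metric.ball_mem_nhds _ one_pos)
      (Eventually.of_forall fun v => ?_) ?_ ?_ (ae_of_all _ fun z v hv => ?_)
      ((integrable_exp_mul_norm_stdGaussian 2).const_mul M) (ae_of_all _ fun z v _ => ?_)
    · simpa [w] using key
    · apply Continuous.aestronglyMeasurable
      fun_prop
    · simp only [w, inner_zero_left, norm_zero]
      norm_num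
      exact Integrable.of_bound hg.aestronglyMeasurable M (ae_of_all _ fun _ => hM _)
    · simp only [w, inner_zero_left, norm_zero]
      norm_num
      exact (continuous_smulRight_inner continuous_id hg).aestronglyMeasurable
    · rw [ContinuousLinearMap.norm_smulRight_apply, norm_smul, innerSL_apply_norm,
        Real.norm_of_nonneg (Real.exp_pos _).le]
      have h1 : ‖z - v‖ ≤ Real.exp ‖z‖ := by
        rw [mem_ball_zero_iff] at hv
        have := norm_sub_le z v
        have := Real.add_one_le_exp ‖z‖
        linarith
      have h2 := hw_le v hv z
      have h3 : ‖g z‖ ≤ M := hM _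
      calc w v z * ‖z - v‖ * ‖g z‖ ≤ Real.exp ‖z‖ * Real.exp ‖z‖ * M := by gcongr
        _ = M * Real.exp (2 * ‖z‖) := by rw [← Real.exp_add]; ring_nf
    · have h1 : HasFDerivAt (fun v : E => ⟪v, z⟫ - ‖v‖ ^ 2 / 2) (innerSL ℝ (z - v)) v := by
        have h2 : HasFDerivAt (fun v : E => ‖v‖ ^ 2) (2 • innerSL ℝ v) v :=
          (hasStrictFDerivAt_norm_sq v).hasFDerivAt
        have h3 : HasFDerivAt (fun v : E => ⟪v, z⟫) (innerSL ℝ z) v := by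
          have := (innerSL ℝ z).hasFDerivAt (x := v)
          refine this.congr_of_eventuallyEq (Eventually.of_forall fun u => ?_)
          simp [real_inner_comm]
        have h4 := h3.sub (h2.mul_const (1 / 2))
        refine (h4.congr_fderiv ?_).congr_of_eventuallyEq (Eventually.of_forall fun u => ?_)
        · ext u
          simp
        · simp [div_eq_mul_inv]
      exact h1.exp.smul_const (g z)
  have hG' : HasFDerivAt (fun v => ∫ z, w v z • g z ∂stdGaussian E)
      (∫ z, (innerSL ℝ z).smulRight (g z) ∂stdGaussian E) (a⁻¹ • (x - x)) := by
    simpa using hG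
  have hl : HasFDerivAt (fun y : E => a⁻¹ • (y - x)) (a⁻¹ • ContinuousLinearMap.id ℝ E) x :=
    ((hasFDerivAt_id x).sub_const x).const_smul a⁻¹
  have h := hG'.comp x hl
  refine (h.congr_of_eventuallyEq (Eventually.of_forall fun y => ?_)).congr_fderiv ?_
  · have := heat_comp_add s f x (a⁻¹ • (y - x)) t
    rw [← ha_def, smul_smul, mul_inv_cancel₀ ha.ne', one_smul, add_sub_cancel] at this
    exact this
  · rw [ContinuousLinearMap.comp_smul, ContinuousLinearMap.comp_id]
    rfl

lemma hasFDerivAt_heat_of_hasFDerivAt {f' : E × ℝ → E →L[ℝ] F} {M' : ℝ} (hf : Continuous f)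
    (hM : ∀ X, ‖f X‖ ≤ M) (hf' : Continuous f') (hM' : ∀ X, ‖f' X‖ ≤ M')
    (hd : ∀ x t, HasFDerivAt (fun y => f (y, t)) (f' (x, t)) x) (s : ℝ) (x : E) (t : ℝ) :
    HasFDerivAt (fun y => heat s f (y, t)) (heat s f' (x, t)) x := by
  refine hasFDerivAt_integral_of_dominated_of_fderiv_le (𝕜 := ℝ) (μ := stdGaussian E)
    (s := univ) (F := fun y z => f (y + √(2 * s) • z, t - s))
    (F' := fun y z => f' (y + √(2 * s) • z, t - s)) (bound := fun _ => M') univ_mem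
    (Eventually.of_forall fun y => ?_) (integrable_gaussKernel hf hM (x, t) s) ?_
    (ae_of_all _ fun z y _ => hM' _) (integrable_const _) (ae_of_all _ fun z y _ => ?_)
  · exact (continuous_gaussKernel (y, t) s hf).aestronglyMeasurable
  · exact (continuous_gaussKernel (x, t) s hf').aestronglyMeasurable
  · exact (hd (y + √(2 * s) • z) (t - s)).comp y ((hasFDerivAt_id y).add_const _)

lemma heat_heat [CompleteSpace F] (hf : Continuous f) (hM : ∀ X, ‖f X‖ ≤ M) {s r : ℝ}
    (hs : 0 ≤ s) (hr : 0 ≤ r) : heat s (heat r f) = heat (s + r) f := by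
  ext X
  have h := integral_integral_stdGaussian (E := E) (a := √(2 * s)) (b := √(2 * r))
    (c := √(2 * (s + r))) (f := fun y => f (X.1 + y, X.2 - (s + r)))
    (by rw [Real.sq_sqrt, Real.sq_sqrt, Real.sq_sqrt] <;> linarith) (by fun_prop)
    (M := M) fun _ => hM _
  simp only [heat]
  rw [← h]
  congr 1
  ext z
  congr 1
  ext w
  congr 2
  · rw [add_assoc]
  · ring

lemma heatGrad_heat [CompleteSpace F] (hf : Continuous f) (hM : ∀ X, ‖f X‖ ≤ M) {s r : ℝ}
    (hs : 0 < s) (hr : 0 ≤ r) : heatGrad s (heat r f) = heatGrad (s + r) f := by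
  ext1 X
  have h1 := hasFDerivAt_heat hs (continuous_heat hf hM r) (norm_heat_le hM r) X.1 X.2
  rw [heat_heat hf hM hs.le hr] at h1
  exact h1.unique (hasFDerivAt_heat (by positivity) hf hM X.1 X.2)

lemma heat_heatGrad [CompleteSpace F] (hf : Continuous f) (hM : ∀ X, ‖f X‖ ≤ M) {s r : ℝ}
    (hs : 0 < s) (hr : 0 ≤ r) : heat r (heatGrad s f) = heatGrad (s + r) f := by
  ext1 X
  have h1 := hasFDerivAt_heat_of_hasFDerivAt (continuous_heat hf hM s) (norm_heat_le hM s)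
    (continuous_heatGrad hf hM s) (norm_heatGrad_le hM s) (hasFDerivAt_heat hs hf hM) r X.1 X.2
  rw [heat_heat hf hM hr hs.le, add_comm] at h1
  exact h1.unique (hasFDerivAt_heat (by positivity) hf hM X.1 X.2)

lemma continuous_heatHess (hf : Continuous f) (hM : ∀ X, ‖f X‖ ≤ M) (s : ℝ) :
    Continuous (heatHess s f) :=
  continuous_heatGrad (continuous_heatGrad hf hM _) (norm_heatGrad_le hM _) _

lemma norm_heatHess_le (hM : ∀ X, ‖f X‖ ≤ M) (s : ℝ) (X : E × ℝ) : ‖heatHess s f X‖ ≤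
    (√(2 * (s / 2)))⁻¹ * (gaussMoment E 1 * ((√(2 * (s / 2)))⁻¹ * (gaussMoment E 1 * M))) :=
  norm_heatGrad_le (norm_heatGrad_le hM _) _ X

lemma hasFDerivAt_heatGrad [CompleteSpace F] (hf : Continuous f) (hM : ∀ X, ‖f X‖ ≤ M) {s : ℝ}
    (hs : 0 < s) (x : E) (t : ℝ) :
    HasFDerivAt (fun y => heatGrad s f (y, t)) (heatHess s f (x, t)) x := by
  have h := hasFDerivAt_heat (half_pos hs) (continuous_heatGrad hf hM (s / 2))
    (norm_heatGrad_le hM (s / 2)) x t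
  rwa [heat_heatGrad hf hM (half_pos hs) (half_pos hs).le, add_halves] at h

lemma heat_heatHess [CompleteSpace F] (hf : Continuous f) (hM : ∀ X, ‖f X‖ ≤ M) {s r : ℝ}
    (hs : 0 < s) (hr : 0 ≤ r) : heat r (heatHess s f) = heatHess (s + r) f := by
  ext1 X
  have h1 := hasFDerivAt_heat_of_hasFDerivAt (continuous_heatGrad hf hM s)
    (norm_heatGrad_le hM s) (continuous_heatHess hf hM s) (norm_heatHess_le hM s)
    (hasFDerivAt_heatGrad hf hM hs) r X.1 X.2
  rw [heat_heatGrad hf hM hs hr] at h1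
  exact h1.unique (hasFDerivAt_heatGrad hf hM (by positivity) X.1 X.2)

lemma measurable_gaussArg : Measurable fun q : (ℝ × E × ℝ) × E =>
    (q.1.1, (q.1.2.1 + √(2 * q.1.1) • q.2, q.1.2.2 - q.1.1)) := by
  refine Continuous.measurable ?_
  fun_prop

lemma stronglyMeasurable_heat {Φ : ℝ → E × ℝ → F} (hΦ : StronglyMeasurable (Function.uncurry Φ)) :
    StronglyMeasurable fun p : ℝ × E × ℝ => heat p.1 (Φ p.1) p.2 := by
  have h := hΦ.comp_measurable (measurable_gaussArg (E := E))
  exact h.integral_prod_right' (ν := stdGaussian E)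

lemma stronglyMeasurable_heatGrad {Φ : ℝ → E × ℝ → F}
    (hΦ : StronglyMeasurable (Function.uncurry Φ)) :
    StronglyMeasurable fun p : ℝ × E × ℝ => heatGrad p.1 (Φ p.1) p.2 := by
  have h := hΦ.comp_measurable (measurable_gaussArg (E := E))
  have h1 : StronglyMeasurable fun q : (ℝ × E × ℝ) × E => innerSL ℝ q.2 :=
    Continuous.stronglyMeasurable (by fun_prop)
  have h2 := (ContinuousLinearMap.smulRightL ℝ E F).continuous₂.comp_stronglyMeasurable
    (h1.prodMk h)
  have h3 := h2.integral_prod_right' (ν := stdGaussian E)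
  have h4 : Measurable fun p : ℝ × E × ℝ => (√(2 * p.1))⁻¹ := by fun_prop
  exact h4.stronglyMeasurable.smul h3

lemma stronglyMeasurable_heatHess {Φ : ℝ → E × ℝ → F}
    (hΦ : StronglyMeasurable (Function.uncurry Φ)) :
    StronglyMeasurable fun p : ℝ × E × ℝ => heatHess p.1 (Φ (p.1 / 2)) p.2 := by
  have h := stronglyMeasurable_heatGrad (Φ := fun s => heatGrad s (Φ s))
    (stronglyMeasurable_heatGrad hΦ)
  have hm : Measurable fun p : ℝ × E × ℝ => (p.1 / 2, p.2) := by fun_prop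
  exact h.comp_measurable hm

end Semigroup

/-! ### Periodic functions and averages over the unit cube -/

section Cube

variable {n : ℕ} {F : Type*}

/-- The standard basis of `ℝⁿ`. -/
abbrev stdBasis (n : ℕ) : Module.Basis (Fin n) ℝ (EuclideanSpace ℝ (Fin n)) :=
  (EuclideanSpace.basisFun (Fin n) ℝ).toBasis

/-- Period one in each of the coordinates of `ℝⁿ`. -/
def IsSpacePeriodic (g : EuclideanSpace ℝ (Fin n) → F) : Prop :=
  ∀ (i : Fin n) (x : EuclideanSpace ℝ (Fin n)), g (x + EuclideanSpace.single i 1) = g x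

lemma IsSpacePeriodic.add_of_mem_span {g : EuclideanSpace ℝ (Fin n) → F} (hg : IsSpacePeriodic g)
    {v : EuclideanSpace ℝ (Fin n)} (hv : v ∈ Submodule.span ℤ (range (stdBasis n)))
    (x : EuclideanSpace ℝ (Fin n)) : g (x + v) = g x := by
  have : Function.Periodic g v := by
    induction hv using Submodule.span_induction with
    | mem v hv =>
      obtain ⟨i, rfl⟩ := hv
      intro x
      simpa using hg i x
    | zero => intro x; simp
    | add v w _ _ hv hw => exact hv.add_period hw
    | smul k v _ hv => exact hv.zsmul k
  exact this x

/-- A periodic function with bounded derivative has bounded oscillation: two points of the torus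
are at distance at most `n`. -/
lemma IsSpacePeriodic.norm_sub_le [NormedAddCommGroup F] [NormedSpace ℝ F]
    {g : EuclideanSpace ℝ (Fin n) → F} (hg : IsSpacePeriodic g)
    {g' : EuclideanSpace ℝ (Fin n) → EuclideanSpace ℝ (Fin n) →L[ℝ] F} {M : ℝ}
    (hd : ∀ x, HasFDerivAt g (g' x) x) (hM : ∀ x, ‖g' x‖ ≤ M) (x y : EuclideanSpace ℝ (Fin n)) :
    ‖g x - g y‖ ≤ M * n := by
  have hM0 : 0 ≤ M := (norm_nonneg _).trans (hM 0)
  have h1 : g x = g (y + ZSpan.fract (stdBasis n) (x - y)) := by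
    rw [ZSpan.fract_apply, ← hg.add_of_mem_span (ZSpan.floor (stdBasis n) (x - y)).2 (y + _)]
    congr 1
    abel
  have h2 : ‖ZSpan.fract (stdBasis n) (x - y)‖ ≤ n := by
    refine (ZSpan.norm_fract_le (K := ℝ) (stdBasis n) (x - y)).trans ?_
    simp
  rw [h1]
  refine (convex_univ.norm_image_sub_le_of_norm_hasFDerivWithin_le
    (fun z _ => (hd z).hasFDerivWithinAt) (fun z _ => hM z) (mem_univ y) (mem_univ _)).trans ?_
  rw [add_sub_cancel_left]
  exact mul_le_mul_of_nonneg_left h2 hM0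

/-- The closed unit cube of `ℝⁿ`. -/
def spaceCube (n : ℕ) : Set (EuclideanSpace ℝ (Fin n)) := {x | ∀ i, x i ∈ Icc (0 : ℝ) 1}

lemma spaceCube_eq_preimage :
    spaceCube n = (MeasurableEquiv.toLp 2 (Fin n → ℝ)).symm ⁻¹' (Icc 0 1) := by
  ext x
  simp [spaceCube, Pi.le_def, forall_and]

lemma isCompact_spaceCube : IsCompact (spaceCube n) := by
  have h : spaceCube n = (EuclideanSpace.equiv (Fin n) ℝ).toHomeomorph ⁻¹' (Icc 0 1) := by
    ext x
    simp [spaceCube, Pi.le_def, forall_and]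
  rw [h, Homeomorph.isCompact_preimage]
  exact isCompact_Icc

lemma volume_spaceCube : volume (spaceCube n) = 1 := by
  rw [spaceCube_eq_preimage,
    (EuclideanSpace.volume_preserving_symm_measurableEquiv_toLp (Fin n)).measure_preimage
      measurableSet_Icc.nullMeasurableSet, Real.volume_Icc_pi]
  simp

lemma fundamentalDomain_ae_eq_spaceCube :
    ZSpan.fundamentalDomain (stdBasis n) =ᵐ[volume] spaceCube n := by
  have h := (EuclideanSpace.volume_preserving_symm_measurableEquiv_toLp
    (Fin n)).quasiMeasurePreserving.preimage_ae_eq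
    (Measure.univ_pi_Ico_ae_eq_Icc (μ := fun _ : Fin n => (volume : Measure ℝ))
      (f := 0) (g := 1))
  rw [← spaceCube_eq_preimage] at h
  have heq : ZSpan.fundamentalDomain (stdBasis n) = (MeasurableEquiv.toLp 2 (Fin n → ℝ)).symm ⁻¹'
      univ.pi fun i : Fin n => Ico ((0 : Fin n → ℝ) i) ((1 : Fin n → ℝ) i) := by
    ext x
    simp [ZSpan.mem_fundamentalDomain]
  rwa [heq]

instance : IsProbabilityMeasure (volume.restrict (spaceCube n)) :=
  ⟨by rw [Measure.restrict_apply_univ, volume_spaceCube]⟩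

lemma IsSpacePeriodic.setIntegral_add [NormedAddCommGroup F] [NormedSpace ℝ F]
    {g : EuclideanSpace ℝ (Fin n) → F} (hg : IsSpacePeriodic g) (v : EuclideanSpace ℝ (Fin n)) :
    ∫ x in spaceCube n, g (x + v) = ∫ x in spaceCube n, g x := by
  have : Countable (Submodule.span ℤ (range (stdBasis n))).toAddSubgroup :=
    inferInstanceAs (Countable (Submodule.span ℤ (range (stdBasis n))))
  have hD := ZSpan.isAddFundamentalDomain' (stdBasis n) volume
  have hD' := hD.vadd_of_comm v
  have h1 := hD'.setIntegral_eq hD (f := g) fun w x => by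
    rw [AddSubgroup.vadd_def, vadd_eq_add, add_comm]
    exact hg.add_of_mem_span w.2 x
  rw [← setIntegral_congr_set fundamentalDomain_ae_eq_spaceCube,
    ← setIntegral_congr_set fundamentalDomain_ae_eq_spaceCube, ← h1]
  rw [← image_vadd, (measurePreserving_vadd v volume).setIntegral_image_emb
    (measurableEmbedding_const_vadd v)]
  simp [add_comm]

lemma unitCube_eq_prod : unitCube n = spaceCube n ×ˢ Icc (0 : ℝ) 1 := rfl

lemma isCompact_unitCube : IsCompact (unitCube n) := isCompact_spaceCube.prod isCompact_Icc

instance : IsProbabilityMeasure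
    ((volume : Measure (EuclideanSpace ℝ (Fin n) × ℝ)).restrict (unitCube n)) :=
  ⟨by
    rw [Measure.restrict_apply_univ, unitCube_eq_prod, Measure.volume_eq_prod, Measure.prod_prod,
      volume_spaceCube, Real.volume_Icc]
    simp⟩

lemma setIntegral_unitCube [NormedAddCommGroup F] [NormedSpace ℝ F]
    {f : EuclideanSpace ℝ (Fin n) × ℝ → F} (hf : Continuous f) :
    ∫ X in unitCube n, f X = ∫ t in (0 : ℝ)..1, ∫ x in spaceCube n, f (x, t) := by
  have hi : IntegrableOn f (spaceCube n ×ˢ Icc (0 : ℝ) 1) (volume.prod volume) :=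
    hf.continuousOn.integrableOn_compact isCompact_unitCube
  rw [IntegrableOn, ← Measure.prod_restrict] at hi
  rw [unitCube_eq_prod, Measure.volume_eq_prod, ← Measure.prod_restrict, integral_prod_symm _ hi,
    intervalIntegral.integral_of_le zero_le_one, integral_Icc_eq_integral_Ioc]

/-- Period one in `x₁, …, xₙ` and in `t`. -/
def IsPeriodic (f : EuclideanSpace ℝ (Fin n) × ℝ → F) : Prop :=
  (∀ t, IsSpacePeriodic fun x => f (x, t)) ∧ ∀ x, Function.Periodic (fun t => f (x, t)) 1

lemma isSpaceTimePeriodic_iff (hn : 1 ≤ n) {u : EuclideanSpace ℝ (Fin n) × ℝ → ℝ} :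
    IsSpaceTimePeriodic u ↔ IsPeriodic u := by
  constructor
  · intro h
    refine ⟨fun t i x => ?_, fun x t => ?_⟩
    · simpa using h x t 1 0 i
    · have := h x (t + 1) 0 1 ⟨0, hn⟩
      simpa using this.symm
  · intro h x t k l i
    have h1 := ((h.2 (x + (k : ℝ) • EuclideanSpace.single i (1 : ℝ))).nat_mul l).sub_eq t
    simp only [mul_one] at h1
    rw [h1]
    have h2 : Function.Periodic (fun x => u (x, t)) (EuclideanSpace.single i (1 : ℝ)) :=
      fun x => h.1 t i x
    simpa [Nat.cast_smul_eq_nsmul] using h2.nsmul k x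

lemma IsPeriodic.setIntegral_add [NormedAddCommGroup F] [NormedSpace ℝ F]
    {f : EuclideanSpace ℝ (Fin n) × ℝ → F} (hp : IsPeriodic f) (hf : Continuous f)
    (V : EuclideanSpace ℝ (Fin n) × ℝ) :
    ∫ X in unitCube n, f (X + V) = ∫ X in unitCube n, f X := by
  rw [setIntegral_unitCube hf, setIntegral_unitCube (f := fun X => f (X + V)) (by fun_prop)]
  have h1 : ∀ t, ∫ x in spaceCube n, f ((x, t) + V) = ∫ x in spaceCube n, f (x, t + V.2) :=
    fun t => (hp.1 (t + V.2)).setIntegral_add V.1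
  simp_rw [h1]
  rw [intervalIntegral.integral_comp_add_right (fun t => ∫ x in spaceCube n, f (x, t))]
  have hper : Function.Periodic (fun t => ∫ x in spaceCube n, f (x, t)) 1 := fun t => by
    simp only
    congr 1
    ext x
    exact hp.2 x t
  have := hper.intervalIntegral_add_eq V.2 0
  rw [zero_add, add_comm V.2 1] at this
  rwa [zero_add]

/-- A continuous periodic function is bounded. -/
lemma IsPeriodic.exists_bound [NormedAddCommGroup F] {f : EuclideanSpace ℝ (Fin n) × ℝ → F}
    (hp : IsPeriodic f) (hf : Continuous f) : ∃ M, ∀ X, ‖f X‖ ≤ M := by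
  obtain ⟨M, hM⟩ := isCompact_unitCube.exists_bound_of_continuousOn hf.continuousOn
  refine ⟨M, fun X => ?_⟩
  have h1 : f X = f (ZSpan.fract (stdBasis n) X.1, X.2) := by
    rw [ZSpan.fract_apply]
    have := (hp.1 X.2).add_of_mem_span (ZSpan.floor (stdBasis n) X.1).2
      (X.1 - ZSpan.floor (stdBasis n) X.1)
    simpa using this
  have h2 : f (ZSpan.fract (stdBasis n) X.1, X.2) =
      f (ZSpan.fract (stdBasis n) X.1, Int.fract X.2) := by
    have := ((hp.2 (ZSpan.fract (stdBasis n) X.1)).int_mul ⌊X.2⌋) (Int.fract X.2)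
    simpa [Int.fract_add_floor] using this
  rw [h1, h2]
  refine hM _ ⟨fun i => ?_, ⟨Int.fract_nonneg _, (Int.fract_lt_one _).le⟩⟩
  have := ZSpan.fract_mem_fundamentalDomain (stdBasis n) X.1
  rw [ZSpan.mem_fundamentalDomain] at this
  have := this i
  simp only [OrthonormalBasis.coe_toBasis_repr_apply, EuclideanSpace.basisFun_repr] at this
  exact ⟨this.1, this.2.le⟩

end Cube

/-! ### Smoothing and decay estimates -/

section Smoothing

variable {E : Type*} [NormedAddCommGroup E] [InnerProductSpace ℝ E] [FiniteDimensional ℝ E]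
  [MeasurableSpace E] [BorelSpace E] {f : E × ℝ → ℝ} {M : ℝ}

lemma inv_sqrt_two_mul_le {s : ℝ} (hs : 0 < s) : (√(2 * s))⁻¹ ≤ s ^ (-(1 / 2) : ℝ) := by
  rw [Real.sqrt_eq_rpow, ← Real.rpow_neg (by positivity)]
  exact Real.rpow_le_rpow_of_nonpos hs (by linarith) (by norm_num)

lemma norm_heatGrad_le_rpow {F : Type*} [NormedAddCommGroup F] [NormedSpace ℝ F]
    {g : E × ℝ → F} (hM : ∀ X, ‖g X‖ ≤ M) {s : ℝ} (hs : 0 < s)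
    (X : E × ℝ) :
    ‖heatGrad s g X‖ ≤ gaussMoment E 1 * s ^ (-(1 / 2) : ℝ) * M := by
  have hM0 : 0 ≤ M := (norm_nonneg _).trans (hM (0, 0))
  refine (norm_heatGrad_le hM s X).trans ?_
  have h1 := inv_sqrt_two_mul_le hs
  have h2 := gaussMoment_nonneg E 1
  calc _ ≤ s ^ (-(1 / 2) : ℝ) * (gaussMoment E 1 * M) := by gcongr
    _ = _ := by ring

lemma half_rpow {s : ℝ} (hs : 0 < s) (p : ℝ) : (s / 2) ^ p = (1 / 2) ^ p * s ^ p := by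
  rw [← Real.mul_rpow (by norm_num) hs.le]
  congr 1
  ring

/-- The Lipschitz constant of `heatHess s f` in space, i.e. the bound on the third derivatives. -/
lemma lipschitz_heatHess {K p : ℝ} (hf : Continuous f) (hM : ∀ X, ‖f X‖ ≤ M)
    (hK : ∀ s, 0 < s → ∀ X, ‖heatHess s f X‖ ≤ K * s ^ p) {s : ℝ} (hs : 0 < s)
    (x y : E) (t : ℝ) :
    ‖heatHess s f (x, t) - heatHess s f (y, t)‖ ≤ gaussMoment E 1 * K *
      (1 / 2) ^ (-(1 / 2) + p) * s ^ (-(1 / 2) + p) * ‖x - y‖ := by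
  have hs2 := half_pos hs
  have h1 : heatHess s f = heat (s / 2) (heatHess (s / 2) f) := by
    rw [heat_heatHess hf hM hs2 hs2.le, add_halves]
  have h2 := convex_univ.norm_image_sub_le_of_norm_hasFDerivWithin_le
    (f := fun z => heatHess s f (z, t)) (x := y) (y := x)
    (fun z _ => by
      rw [h1]
      exact (hasFDerivAt_heat hs2 (continuous_heatHess hf hM _)
        (hK _ hs2) z t).hasFDerivWithinAt)
    (fun z _ => norm_heatGrad_le_rpow (hK _ hs2) hs2 _) (mem_univ y) (mem_univ x)
  refine h2.trans_eq ?_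
  have h3 : (s / 2) ^ (-(1 / 2) : ℝ) * (s / 2) ^ p =
      (1 / 2) ^ (-(1 / 2) + p) * s ^ (-(1 / 2) + p) := by
    rw [← Real.rpow_add hs2, ← half_rpow hs]
  linear_combination gaussMoment E 1 * K * ‖x - y‖ * h3

/-- The family `Φ` of functions of space-time decays like `K s ^ p` for small and `K s ^ q` for
large `s`. -/
def DecayBound {E F : Type*} [NormedAddCommGroup F] (Φ : ℝ → E × ℝ → F) (K p q : ℝ) : Prop :=
  ∀ s, 0 < s → ∀ X, ‖Φ s X‖ ≤ K * min (s ^ p) (s ^ q)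

lemma decayBound_of_le {E F : Type*} [NormedAddCommGroup F] {Φ : ℝ → E × ℝ → F} {K₁ K₂ p q : ℝ}
    (h₁ : ∀ s, 0 < s → ∀ X, ‖Φ s X‖ ≤ K₁ * s ^ p) (h₂ : ∀ s, 0 < s → ∀ X, ‖Φ s X‖ ≤ K₂ * s ^ q) :
    DecayBound Φ (max (max K₁ K₂) 0) p q := by
  intro s hs X
  have hp : 0 < s ^ p := by positivity
  have hq : 0 < s ^ q := by positivity
  rcases min_choice (s ^ p) (s ^ q) with h | h <;> rw [h]
  · exact (h₁ s hs X).trans (by gcongr; simp)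
  · exact (h₂ s hs X).trans (by gcongr; simp)

end Smoothing

section Decay

variable {n : ℕ} {f : EuclideanSpace ℝ (Fin n) × ℝ → ℝ} {M H α : ℝ}

lemma norm_heatGrad_le_rpow_of_holder (hf : Continuous f) (hM : ∀ X, ‖f X‖ ≤ M)
    (hα : α ∈ Ioo (0 : ℝ) 1) (hH0 : 0 ≤ H)
    (hH : ∀ x y t, ‖f (x, t) - f (y, t)‖ ≤ H * ‖x - y‖ ^ α) {s : ℝ} (hs : 0 < s)
    (X : EuclideanSpace ℝ (Fin n) × ℝ) :
    ‖heatGrad s f X‖ ≤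
      gaussMoment (EuclideanSpace ℝ (Fin n)) (1 + α) * H * s ^ ((α - 1) / 2) := by
  refine (norm_heatGrad_le_of_holder hf hM hα.1.le hH s X).trans ?_
  have h2 := gaussMoment_nonneg (EuclideanSpace ℝ (Fin n)) (1 + α)
  have h3 : (√(2 * s))⁻¹ * √(2 * s) ^ α ≤ s ^ ((α - 1) / 2) := by
    have h4 : (√(2 * s))⁻¹ * √(2 * s) ^ α = (2 * s) ^ ((α - 1) / 2) := by
      rw [Real.sqrt_eq_rpow, ← Real.rpow_neg (by positivity), ← Real.rpow_mul (by positivity),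
        ← Real.rpow_add (by positivity)]
      congr 1
      ring
    rw [h4]
    exact Real.rpow_le_rpow_of_nonpos hs (by linarith) (by linarith [hα.2])
  calc _ = gaussMoment (EuclideanSpace ℝ (Fin n)) (1 + α) * H *
        ((√(2 * s))⁻¹ * √(2 * s) ^ α) := by ring
    _ ≤ _ := by gcongr

/-- Continuous functions on space-time which, at each time, are periodic in space with zero
mean. -/
structure IsZeroMean (f : EuclideanSpace ℝ (Fin n) × ℝ → ℝ) : Prop where
  continuous : Continuous f
  periodic : ∀ t, IsSpacePeriodic fun x => f (x, t)
  mean : ∀ t, ∫ x in spaceCube n, f (x, t) = 0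

lemma isSpacePeriodic_heat (hp : ∀ t, IsSpacePeriodic fun x => f (x, t)) (s t : ℝ) :
    IsSpacePeriodic fun x => heat s f (x, t) := by
  intro i x
  simp only [heat]
  congr 1
  ext z
  refine Eq.trans ?_ (hp (t - s) i (x + √(2 * s) • z))
  simp only [add_right_comm]

lemma IsZeroMean.heat (hf : IsZeroMean f) (hM : ∀ X, ‖f X‖ ≤ M) (s : ℝ) :
    IsZeroMean (heat s f) where
  continuous := continuous_heat hf.continuous hM s
  periodic := isSpacePeriodic_heat hf.periodic s
  mean t := by
    simp only [TorusHeat.heat]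
    have hc := hf.continuous
    rw [integral_integral_swap]
    · simp [(hf.periodic (t - s)).setIntegral_add, hf.mean]
    · refine Integrable.of_bound (C := M) (Continuous.aestronglyMeasurable ?_)
        (ae_of_all _ fun _ => hM _)
      fun_prop

lemma norm_le_of_mean_zero {g : EuclideanSpace ℝ (Fin n) → ℝ} {A : ℝ} (hg : Continuous g)
    (h0 : ∫ x in spaceCube n, g x = 0) (hA : ∀ x y, ‖g x - g y‖ ≤ A)
    (x : EuclideanSpace ℝ (Fin n)) : ‖g x‖ ≤ A := by
  have h1 : g x = ∫ y in spaceCube n, (g x - g y) := by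
    rw [integral_sub (integrable_const _)
      (hg.continuousOn.integrableOn_compact isCompact_spaceCube), h0]
    simp
  rw [h1]
  simpa using norm_integral_le_of_norm_le_const (μ := volume.restrict (spaceCube n))
    (ae_of_all _ fun y => hA x y)

/-- On mean-zero periodic functions the gradient bound of the heat flow yields decay. -/
lemma IsZeroMean.norm_heat_le (hf : IsZeroMean f) (hM : ∀ X, ‖f X‖ ≤ M) {s : ℝ} (hs : 0 < s)
    (X : EuclideanSpace ℝ (Fin n) × ℝ) :
    ‖TorusHeat.heat s f X‖ ≤
      gaussMoment (EuclideanSpace ℝ (Fin n)) 1 * n * s ^ (-(1 / 2) : ℝ) * M := by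
  have h1 := norm_le_of_mean_zero (g := fun x => TorusHeat.heat s f (x, X.2))
    ((continuous_heat hf.continuous hM s).comp (by fun_prop)) ((hf.heat hM s).mean X.2)
    (((hf.heat hM s).periodic X.2).norm_sub_le
      (fun x => hasFDerivAt_heat hs hf.continuous hM x X.2)
      (fun x => norm_heatGrad_le_rpow hM hs _)) X.1
  refine h1.trans_eq ?_
  ring

/-- The decay rate `s ^ (-3/2)` comes from splitting the flow into three steps, each gaining
`s ^ (-1/2)`. -/
lemma IsZeroMean.norm_heat_le_rpow (hf : IsZeroMean f) (hM : ∀ X, ‖f X‖ ≤ M) :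
    ∃ K, 0 ≤ K ∧ ∀ s, 0 < s → ∀ X, ‖TorusHeat.heat s f X‖ ≤ K * s ^ (-(3 / 2) : ℝ) := by
  have hM0 : 0 ≤ M := (norm_nonneg _).trans (hM (0, 0))
  set κ := gaussMoment (EuclideanSpace ℝ (Fin n)) 1 * n with hκ
  have hκ0 : 0 ≤ κ := mul_nonneg (gaussMoment_nonneg _ _) (Nat.cast_nonneg n)
  refine ⟨κ ^ 3 * M * (1 / 3) ^ (-(3 / 2) : ℝ), by positivity, fun s hs X => ?_⟩
  have hs3 : 0 < s / 3 := by positivity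
  have h1 := hf.norm_heat_le hM hs3
  have h2 := (hf.heat hM (s / 3)).norm_heat_le h1 hs3
  have h3 := ((hf.heat hM (s / 3)).heat h1 (s / 3)).norm_heat_le h2 hs3 X
  rw [heat_heat hf.continuous hM hs3.le hs3.le, heat_heat hf.continuous hM hs3.le (by positivity),
    show s / 3 + (s / 3 + s / 3) = s by ring] at h3
  refine h3.trans_eq ?_
  have h4 : ((s / 3) ^ (-(1 / 2) : ℝ)) ^ 3 = (1 / 3) ^ (-(3 / 2) : ℝ) * s ^ (-(3 / 2) : ℝ) := by
    rw [← Real.rpow_natCast, ← Real.rpow_mul hs3.le, ← Real.mul_rpow (by norm_num) hs.le]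
    congr 1 <;> norm_num
    ring
  rw [← hκ]
  linear_combination κ ^ 3 * M * h4

lemma IsZeroMean.decayBound_heat (hf : IsZeroMean f) (hM : ∀ X, ‖f X‖ ≤ M) :
    ∃ K, 0 ≤ K ∧ DecayBound (fun s => TorusHeat.heat s f) K 0 (-(3 / 2)) := by
  obtain ⟨K, -, hK⟩ := hf.norm_heat_le_rpow hM
  exact ⟨_, le_max_right _ _, decayBound_of_le (fun s _ X => by
    simpa using TorusHeat.norm_heat_le hM s X) hK⟩

lemma IsZeroMean.decayBound_heatGrad (hf : IsZeroMean f) (hM : ∀ X, ‖f X‖ ≤ M)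
    (hα : α ∈ Ioo (0 : ℝ) 1) (hH0 : 0 ≤ H)
    (hH : ∀ x y t, ‖f (x, t) - f (y, t)‖ ≤ H * ‖x - y‖ ^ α) :
    ∃ K, 0 ≤ K ∧ DecayBound (fun s => heatGrad s f) K ((α - 1) / 2) (-2) := by
  obtain ⟨K, -, hK⟩ := hf.norm_heat_le_rpow hM
  refine ⟨_, le_max_right _ _, decayBound_of_le (K₂ := gaussMoment (EuclideanSpace ℝ (Fin n)) 1 *
    K * (1 / 2) ^ (-2 : ℝ)) (fun s hs X =>
    norm_heatGrad_le_rpow_of_holder hf.continuous hM hα hH0 hH hs X) fun s hs X => ?_⟩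
  have hs2 := half_pos hs
  have h := norm_heatGrad_le_rpow (hK (s / 2) hs2) hs2 X
  rw [heatGrad_heat hf.continuous hM hs2 hs2.le, add_halves] at h
  refine h.trans_eq ?_
  have h1 : (s / 2) ^ (-(1 / 2) : ℝ) * (s / 2) ^ (-(3 / 2) : ℝ) =
      (1 / 2) ^ (-2 : ℝ) * s ^ (-2 : ℝ) := by
    rw [← Real.rpow_add hs2, ← half_rpow hs]
    norm_num
  linear_combination gaussMoment (EuclideanSpace ℝ (Fin n)) 1 * K * h1

lemma IsZeroMean.decayBound_heatHess (hf : IsZeroMean f) (hM : ∀ X, ‖f X‖ ≤ M)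
    (hα : α ∈ Ioo (0 : ℝ) 1) (hH0 : 0 ≤ H)
    (hH : ∀ x y t, ‖f (x, t) - f (y, t)‖ ≤ H * ‖x - y‖ ^ α) :
    ∃ K, 0 ≤ K ∧ DecayBound (fun s => heatHess s f) K (α / 2 - 1) (-(5 / 2)) := by
  obtain ⟨K, -, hK⟩ := hf.decayBound_heatGrad hM hα hH0 hH
  have h : ∀ s, 0 < s → ∀ X, ∀ p : ℝ, (∀ Y, ‖heatGrad (s / 2) f Y‖ ≤ K * (s / 2) ^ p) →
      ‖heatHess s f X‖ ≤ gaussMoment (EuclideanSpace ℝ (Fin n)) 1 * K *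
        (1 / 2) ^ (-(1 / 2) + p) * s ^ (-(1 / 2) + p) := by
    intro s hs X p hp
    have hs2 := half_pos hs
    refine (norm_heatGrad_le_rpow hp hs2 X).trans_eq ?_
    have h1 : (s / 2) ^ (-(1 / 2) : ℝ) * (s / 2) ^ p =
        (1 / 2) ^ (-(1 / 2) + p) * s ^ (-(1 / 2) + p) := by
      rw [← Real.rpow_add hs2, ← half_rpow hs]
    linear_combination gaussMoment (EuclideanSpace ℝ (Fin n)) 1 * K * h1
  have hK0 : 0 ≤ K := by
    have := (norm_nonneg _).trans (hK 1 one_pos (0, 0))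
    simpa using this
  refine ⟨_, le_max_right _ _, decayBound_of_le
    (K₁ := gaussMoment (EuclideanSpace ℝ (Fin n)) 1 * K * (1 / 2) ^ (-(1 / 2) + (α - 1) / 2))
    (K₂ := gaussMoment (EuclideanSpace ℝ (Fin n)) 1 * K * (1 / 2) ^ (-(1 / 2) + (-2) : ℝ))
    (fun s hs X => ?_) fun s hs X => ?_⟩
  · have h1 := h s hs X ((α - 1) / 2) fun Y => (hK _ (half_pos hs) Y).trans
      (mul_le_mul_of_nonneg_left (min_le_left _ _) hK0)
    rwa [show s ^ (-(1 / 2) + (α - 1) / 2) = s ^ (α / 2 - 1) by congr 1; ring] at h1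
  · have h1 := h s hs X (-2) fun Y => (hK _ (half_pos hs) Y).trans
      (mul_le_mul_of_nonneg_left (min_le_right _ _) hK0)
    rwa [show s ^ (-(1 / 2) + (-2) : ℝ) = s ^ (-(5 / 2) : ℝ) by congr 1; norm_num] at h1

end Decay

/-! ### Potentials: integrating the semigroup over time -/

lemma integrableOn_min_rpow {p q : ℝ} (hp : -1 < p) (hq : q < -1) :
    IntegrableOn (fun s : ℝ => min (s ^ p) (s ^ q)) (Ioi 0) := by
  have hm : Measurable fun s : ℝ => min (s ^ p) (s ^ q) := by fun_prop
  rw [← Ioc_union_Ioi_eq_Ioi zero_le_one]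
  refine IntegrableOn.union ?_ ?_
  · have h : IntegrableOn (fun s : ℝ => s ^ p) (Ioc 0 1) :=
      (intervalIntegrable_iff_integrableOn_Ioc_of_le zero_le_one).1
        (intervalIntegral.intervalIntegrable_rpow' hp)
    refine h.mono' hm.aestronglyMeasurable ((ae_restrict_iff' measurableSet_Ioc).2
      (ae_of_all _ fun s hs => ?_))
    rw [Real.norm_of_nonneg (le_min (Real.rpow_nonneg hs.1.le _) (Real.rpow_nonneg hs.1.le _))]
    exact min_le_left _ _
  · refine (integrableOn_Ioi_rpow_of_lt hq one_pos).mono' hm.aestronglyMeasurable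
      ((ae_restrict_iff' measurableSet_Ioi).2 (ae_of_all _ fun s hs => ?_))
    have hs0 : (0 : ℝ) ≤ s := zero_le_one.trans (le_of_lt hs)
    rw [Real.norm_of_nonneg (le_min (Real.rpow_nonneg hs0 _) (Real.rpow_nonneg hs0 _))]
    exact min_le_right _ _

lemma setIntegral_Ioc_rpow {p τ : ℝ} (hp : -1 < p) (hτ : 0 ≤ τ) :
    ∫ s in Ioc 0 τ, s ^ p = τ ^ (p + 1) / (p + 1) := by
  rw [← intervalIntegral.integral_of_le hτ, integral_rpow (Or.inl hp),
    Real.zero_rpow (by linarith), sub_zero]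

lemma integrableOn_Ioc_rpow {p τ : ℝ} (hp : -1 < p) (hτ : 0 ≤ τ) :
    IntegrableOn (fun s : ℝ => s ^ p) (Ioc 0 τ) :=
  (intervalIntegrable_iff_integrableOn_Ioc_of_le hτ).1
    (intervalIntegral.intervalIntegrable_rpow' hp)

section Potential

variable {E : Type*} [NormedAddCommGroup E] [MeasurableSpace E] {F : Type*} [NormedAddCommGroup F]

/-- A family of continuous functions of space-time, indexed by `s > 0`, with an integrable
majorant `b`. -/
structure IsKernel (Φ : ℝ → E × ℝ → F) (b : ℝ → ℝ) : Prop where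
  meas : StronglyMeasurable (Function.uncurry Φ)
  cont : ∀ s, 0 < s → Continuous (Φ s)
  le : ∀ s, 0 < s → ∀ X, ‖Φ s X‖ ≤ b s
  int : IntegrableOn b (Ioi 0)

variable {Φ : ℝ → E × ℝ → F} {b : ℝ → ℝ}

lemma IsKernel.of_decayBound {K p q : ℝ} (hm : StronglyMeasurable (Function.uncurry Φ))
    (hc : ∀ s, 0 < s → Continuous (Φ s)) (hb : DecayBound Φ K p q) (hp : -1 < p) (hq : q < -1) :
    IsKernel Φ fun s => K * min (s ^ p) (s ^ q) :=
  ⟨hm, hc, hb, (integrableOn_min_rpow hp hq).const_mul K⟩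

lemma IsKernel.aestronglyMeasurable (h : IsKernel Φ b) (X : E × ℝ) (μ : Measure ℝ) :
    AEStronglyMeasurable (fun s => Φ s X) μ :=
  (h.meas.comp_measurable (measurable_id.prodMk measurable_const)).aestronglyMeasurable

lemma IsKernel.ae_le (h : IsKernel Φ b) :
    ∀ᵐ s ∂volume.restrict (Ioi (0 : ℝ)), ∀ X, ‖Φ s X‖ ≤ b s :=
  (ae_restrict_iff' measurableSet_Ioi).2 (ae_of_all _ fun s hs X => h.le s hs X)

lemma IsKernel.integrableOn (h : IsKernel Φ b) (X : E × ℝ) :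
    IntegrableOn (fun s => Φ s X) (Ioi 0) :=
  Integrable.mono' h.int (h.aestronglyMeasurable X _) (h.ae_le.mono fun _ hs => hs X)

variable [NormedSpace ℝ F]

/-- The potential `∫₀^∞ Φ s ds`. -/
def potential (Φ : ℝ → E × ℝ → F) (X : E × ℝ) : F := ∫ s in Ioi 0, Φ s X

lemma IsKernel.norm_potential_le (h : IsKernel Φ b) (X : E × ℝ) :
    ‖potential Φ X‖ ≤ ∫ s in Ioi 0, b s :=
  norm_integral_le_of_norm_le h.int (h.ae_le.mono fun _ hs => hs X)

lemma IsKernel.continuous_potential (h : IsKernel Φ b) : Continuous (potential Φ) :=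
  continuous_of_dominated (fun X => h.aestronglyMeasurable X _)
    (fun X => h.ae_le.mono fun _ hs => hs X) h.int
    ((ae_restrict_iff' measurableSet_Ioi).2 (ae_of_all _ fun s hs => h.cont s hs))

/-- Hölder continuity in space of a potential: the family is bounded by `s ^ (α/2 - 1)` for
`s ≤ r²` and has Lipschitz constant `s ^ (α/2 - 3/2)` for `s > r²`, `r` being the distance of the
points. -/
lemma IsKernel.holder_space (h : IsKernel Φ b) {α K L : ℝ} (hα : α ∈ Ioo (0 : ℝ) 1)
    (hK : ∀ s, 0 < s → ∀ X, ‖Φ s X‖ ≤ K * s ^ (α / 2 - 1))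
    (hL : ∀ s, 0 < s → ∀ x y t, ‖Φ s (x, t) - Φ s (y, t)‖ ≤ L * s ^ ((α - 3) / 2) * ‖x - y‖)
    (x y : E) (t : ℝ) :
    ‖potential Φ (x, t) - potential Φ (y, t)‖ ≤
      (2 * K / (α / 2) + L / ((1 - α) / 2)) * ‖x - y‖ ^ α := by
  obtain ⟨hα0, hα1⟩ := hα
  rcases eq_or_ne x y with rfl | hxy
  · simp [Real.zero_rpow hα0.ne']
  have hr : 0 < ‖x - y‖ := norm_pos_iff.2 (sub_ne_zero.2 hxy)
  set r := ‖x - y‖ with hr_def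
  have hr2 : 0 < r ^ 2 := by positivity
  have hi : IntegrableOn (fun s => Φ s (x, t) - Φ s (y, t)) (Ioi 0) :=
    (h.integrableOn _).sub (h.integrableOn _)
  rw [potential, potential, ← integral_sub (h.integrableOn _) (h.integrableOn _),
    ← Ioc_union_Ioi_eq_Ioi hr2.le, setIntegral_union (Ioc_disjoint_Ioi le_rfl)
    measurableSet_Ioi (hi.mono_set Ioc_subset_Ioi_self) (hi.mono_set (Ioi_subset_Ioi hr2.le)),
    add_mul]
  have hpow : ∀ p : ℝ, (r ^ 2) ^ p = r ^ (2 * p) := fun p => by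
    rw [← Real.rpow_natCast, ← Real.rpow_mul hr.le]
    norm_num
  refine (norm_add_le _ _).trans (add_le_add ?_ ?_)
  · have h1 := norm_integral_le_of_norm_le (μ := volume.restrict (Ioc 0 (r ^ 2)))
      (f := fun s => Φ s (x, t) - Φ s (y, t)) (g := fun s => 2 * K * s ^ (α / 2 - 1))
      ((integrableOn_Ioc_rpow (by linarith) hr2.le).const_mul _)
      ((ae_restrict_iff' measurableSet_Ioc).2 (ae_of_all _ fun s hs => by
        have h2 := hK s hs.1 (x, t)
        have h3 := hK s hs.1 (y, t)
        have h4 := norm_sub_le (Φ s (x, t)) (Φ s (y, t))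
        linarith))
    refine h1.trans_eq ?_
    rw [integral_const_mul, setIntegral_Ioc_rpow (by linarith) hr2.le, hpow,
      show 2 * (α / 2 - 1 + 1) = α by ring, sub_add_cancel]
    ring
  · have h1 := norm_integral_le_of_norm_le (μ := volume.restrict (Ioi (r ^ 2)))
      (f := fun s => Φ s (x, t) - Φ s (y, t)) (g := fun s => L * r * s ^ ((α - 3) / 2))
      ((integrableOn_Ioi_rpow_of_lt (by linarith) hr2).const_mul _)
      ((ae_restrict_iff' measurableSet_Ioi).2 (ae_of_all _ fun s hs => by
        refine (hL s (hr2.trans hs) x y t).trans_eq ?_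
        ring))
    refine h1.trans_eq ?_
    rw [integral_const_mul, integral_Ioi_rpow_of_lt (by linarith) hr2, hpow,
      show 2 * ((α - 3) / 2 + 1) = α - 1 by ring, Real.rpow_sub_one hr.ne']
    have h5 : (1 - α) ≠ 0 := by linarith
    have h6 : (α - 3) / 2 + 1 ≠ 0 := by
      intro h
      apply h5
      linarith
    have h7 : (α - 3) / 2 + 1 = -((1 - α) / 2) := by ring
    rw [h7]
    field_simp

variable [InnerProductSpace ℝ E]

lemma IsKernel.hasFDerivAt_potential (h : IsKernel Φ b) {Ψ : ℝ → E × ℝ → E →L[ℝ] F} {b' : ℝ → ℝ}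
    (h' : IsKernel Ψ b')
    (hd : ∀ s, 0 < s → ∀ x t, HasFDerivAt (fun y => Φ s (y, t)) (Ψ s (x, t)) x) (x : E) (t : ℝ) :
    HasFDerivAt (fun y => potential Φ (y, t)) (potential Ψ (x, t)) x :=
  hasFDerivAt_integral_of_dominated_of_fderiv_le (𝕜 := ℝ) (s := univ)
    (F := fun y s => Φ s (y, t)) (F' := fun y s => Ψ s (y, t)) univ_mem
    (Eventually.of_forall fun y => h.aestronglyMeasurable (y, t) _) (h.integrableOn (x, t))
    (h'.aestronglyMeasurable (x, t) _) (h'.ae_le.mono fun _ hs y _ => hs (y, t)) h'.int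
    ((ae_restrict_iff' measurableSet_Ioi).2 (ae_of_all _ fun s hs y _ => hd s hs y t))

variable [FiniteDimensional ℝ E] [BorelSpace E]

/-- **Duhamel's formula**: the potential of a family on which the semigroup acts by shifts. -/
lemma IsKernel.potential_eq_add_heat [CompleteSpace F] (h : IsKernel Φ b) {τ : ℝ} (hτ : 0 ≤ τ)
    (hΦ : ∀ s, 0 < s → heat τ (Φ s) = Φ (s + τ)) (X : E × ℝ) :
    potential Φ X = (∫ s in Ioc 0 τ, Φ s X) + heat τ (potential Φ) X := by
  have h1 : heat τ (potential Φ) X = ∫ s in Ioi 0, Φ (s + τ) X := by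
    simp only [heat, potential]
    rw [integral_integral_swap]
    · exact setIntegral_congr_fun measurableSet_Ioi fun s hs => congrFun (hΦ s hs) X
    · have hm : Measurable fun q : E × ℝ => (q.2, (X.1 + √(2 * τ) • q.1, X.2 - τ)) := by fun_prop
      refine Integrable.mono' (h.int.comp_snd (stdGaussian E))
        (h.meas.comp_measurable hm).aestronglyMeasurable ?_
      have := (Measure.quasiMeasurePreserving_snd (μ := stdGaussian E)
        (ν := volume.restrict (Ioi (0 : ℝ)))).ae h.ae_le
      exact this.mono fun q hq => hq _
  have h2 : ∫ s in Ioi 0, Φ (s + τ) X = ∫ s in Ioi τ, Φ s X := by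
    rw [← integral_indicator measurableSet_Ioi, ← integral_indicator measurableSet_Ioi]
    conv_rhs => rw [← integral_add_right_eq_self _ τ]
    congr 1
    ext s
    simp [indicator]
  rw [h1, h2, potential, ← Ioc_union_Ioi_eq_Ioi hτ, setIntegral_union (Ioc_disjoint_Ioi le_rfl)
    measurableSet_Ioi ((h.integrableOn X).mono_set Ioc_subset_Ioi_self)
    ((h.integrableOn X).mono_set (Ioi_subset_Ioi hτ))]

lemma norm_heat_sub_le {G : E × ℝ → F} (hG : Continuous G) {M A α : ℝ} (hM : ∀ X, ‖G X‖ ≤ M)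
    [CompleteSpace F] (hα : 0 ≤ α) (hA : ∀ x y t, ‖G (x, t) - G (y, t)‖ ≤ A * ‖x - y‖ ^ α)
    (s : ℝ) (x : E) (t : ℝ) :
    ‖heat s G (x, t) - G (x, t - s)‖ ≤ A * √(2 * s) ^ α * gaussMoment E α := by
  have h1 : heat s G (x, t) - G (x, t - s) =
      ∫ z, (G (x + √(2 * s) • z, t - s) - G (x, t - s)) ∂stdGaussian E := by
    rw [integral_sub (integrable_gaussKernel hG hM (x, t) s) (integrable_const _)]
    simp [heat]
  rw [h1, gaussMoment, ← integral_const_mul]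
  refine norm_integral_le_of_norm_le
    ((integrable_norm_rpow_stdGaussian hα).const_mul _) (ae_of_all _ fun z => ?_)
  refine (hA _ _ _).trans_eq ?_
  rw [add_sub_cancel_left, norm_smul, Real.norm_of_nonneg (Real.sqrt_nonneg _),
    Real.mul_rpow (Real.sqrt_nonneg _) (norm_nonneg z)]
  ring

/-- Hölder continuity in time of a potential follows from Hölder continuity in space: by Duhamel's
formula, a shift in time amounts to a Gaussian average in space up to a short-time integral. -/
lemma IsKernel.holder_time [CompleteSpace F] (h : IsKernel Φ b)
    (hΦ : ∀ τ, 0 ≤ τ → ∀ s, 0 < s → heat τ (Φ s) = Φ (s + τ)) {α K A : ℝ} (hα : 0 < α)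
    (hK : ∀ s, 0 < s → ∀ X, ‖Φ s X‖ ≤ K * s ^ (α / 2 - 1))
    (hA : ∀ x y t, ‖potential Φ (x, t) - potential Φ (y, t)‖ ≤ A * ‖x - y‖ ^ α)
    (x : E) {t₁ t₂ : ℝ} (ht : t₁ ≤ t₂) :
    ‖potential Φ (x, t₂) - potential Φ (x, t₁)‖ ≤
      (K / (α / 2) + A * 2 ^ (α / 2) * gaussMoment E α) * (t₂ - t₁) ^ (α / 2) := by
  set τ := t₂ - t₁ with hτ_def
  have hτ : 0 ≤ τ := sub_nonneg.2 ht
  have h1 := h.potential_eq_add_heat hτ (hΦ τ hτ) (x, t₂)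
  have h2 := norm_heat_sub_le h.continuous_potential h.norm_potential_le hα.le hA τ x t₂
  rw [show t₂ - τ = t₁ by rw [hτ_def]; ring] at h2
  have h3 := norm_integral_le_of_norm_le (μ := volume.restrict (Ioc 0 τ))
      (f := fun s => Φ s (x, t₂)) (g := fun s => K * s ^ (α / 2 - 1))
      ((integrableOn_Ioc_rpow (by linarith) hτ).const_mul _)
      ((ae_restrict_iff' measurableSet_Ioc).2 (ae_of_all _ fun s hs => hK s hs.1 _))
  rw [integral_const_mul, setIntegral_Ioc_rpow (by linarith) hτ, sub_add_cancel] at h3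
  rw [h1, add_sub_assoc]
  refine (norm_add_le _ _).trans ((add_le_add h3 h2).trans_eq ?_)
  rw [Real.sqrt_eq_rpow, ← Real.rpow_mul (by positivity), Real.mul_rpow (by norm_num) hτ,
    show 1 / 2 * α = α / 2 by ring]
  ring

end Potential

/-! ### The heat equation -/

/-- Taylor's formula of order two with Hölder continuous second derivative. -/
lemma norm_taylor_two_le {E : Type*} [NormedAddCommGroup E] [NormedSpace ℝ E] {φ : E → ℝ}
    {φ' : E → E →L[ℝ] ℝ} {φ'' : E → E →L[ℝ] E →L[ℝ] ℝ} {A α : ℝ} (hα : 0 ≤ α) (hA0 : 0 ≤ A)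
    (h1 : ∀ y, HasFDerivAt φ (φ' y) y) (h2 : ∀ y, HasFDerivAt φ' (φ'' y) y) (x v : E)
    (hA : ∀ y, ‖φ'' y - φ'' x‖ ≤ A * ‖y - x‖ ^ α) :
    ‖φ (x + v) - φ x - φ' x v - φ'' x v v / 2‖ ≤ A * ‖v‖ ^ (2 + α) := by
  set B := A * ‖v‖ ^ (2 + α) with hB
  have hB0 : 0 ≤ B := by positivity
  have hl : ∀ τ : ℝ, HasDerivAt (fun τ : ℝ => x + τ • v) v τ := fun τ => by
    simpa using ((hasDerivAt_id τ).smul_const v).const_add x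
  have hd1 : ∀ τ : ℝ, HasDerivAt (fun τ : ℝ => φ (x + τ • v)) (φ' (x + τ • v) v) τ :=
    fun τ => (h1 _).comp_hasDerivAt τ (hl τ)
  have hd2 : ∀ τ : ℝ, HasDerivAt (fun τ : ℝ => φ' (x + τ • v) v) (φ'' (x + τ • v) v v) τ := by
    intro τ
    have h3 : HasDerivAt (fun τ : ℝ => φ' (x + τ • v)) (φ'' (x + τ • v) v) τ :=
      HasFDerivAt.comp_hasDerivAt τ (h2 _) (hl τ)
    exact (ContinuousLinearMap.apply ℝ ℝ v).hasFDerivAt.comp_hasDerivAt τ h3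
  have hk : ∀ τ ∈ Icc (0 : ℝ) 1,
      ‖φ' (x + τ • v) v - φ' x v - τ * φ'' x v v‖ ≤ B := by
    intro τ hτ
    have hd3 : ∀ σ : ℝ, HasDerivAt (fun σ : ℝ => φ' (x + σ • v) v - φ' x v - σ * φ'' x v v)
        (φ'' (x + σ • v) v v - φ'' x v v) σ := fun σ =>
      (((hd2 σ).sub_const (φ' x v)).sub ((hasDerivAt_id σ).mul_const (φ'' x v v))).congr_deriv
        (by simp)
    have := norm_image_sub_le_of_norm_deriv_le_segment_01'
      (f := fun σ : ℝ => φ' (x + (τ * σ) • v) v - φ' x v - (τ * σ) * φ'' x v v)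
      (f' := fun σ => τ * (φ'' (x + (τ * σ) • v) v v - φ'' x v v)) (C := B)
      (fun σ _ => by
        have h3 := (hd3 (τ * σ)).scomp σ ((hasDerivAt_id σ).const_mul τ)
        exact (h3.congr_deriv (by simp)).hasDerivWithinAt)
      (fun σ hσ => by
        have h4 : ‖φ'' (x + (τ * σ) • v) v v - φ'' x v v‖ ≤ B := by
          have h5 := (φ'' (x + (τ * σ) • v) - φ'' x).le_opNorm₂ v v
          have h6 : ‖(τ * σ) • v‖ ≤ ‖v‖ := by
            rw [norm_smul, Real.norm_of_nonneg (mul_nonneg hτ.1 hσ.1)]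
            exact mul_le_of_le_one_left (norm_nonneg v) (mul_le_one₀ hτ.2 hσ.1 hσ.2.le)
          have h7 := hA (x + (τ * σ) • v)
          rw [add_sub_cancel_left] at h7
          calc _ ≤ A * ‖v‖ ^ α * ‖v‖ * ‖v‖ := by
                refine h5.trans ?_
                gcongr
                exact h7.trans (by gcongr)
            _ = B := by
                rw [hB, Real.rpow_add_of_nonneg (norm_nonneg v) (by norm_num) hα, Real.rpow_two]
                ring
        rw [norm_mul, Real.norm_of_nonneg hτ.1]
        exact (mul_le_mul hτ.2 h4 (norm_nonneg _) zero_le_one).trans_eq (one_mul _))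
    simpa using this
  have := norm_image_sub_le_of_norm_deriv_le_segment_01'
    (f := fun τ : ℝ => φ (x + τ • v) - φ x - τ * φ' x v - τ ^ 2 / 2 * φ'' x v v)
    (f' := fun τ => φ' (x + τ • v) v - φ' x v - τ * φ'' x v v) (C := B)
    (fun τ _ => by
      have h3 := (((hd1 τ).sub_const (φ x)).sub ((hasDerivAt_id τ).mul_const (φ' x v))).sub
        ((((hasDerivAt_id τ).pow 2).div_const 2).mul_const (φ'' x v v))
      refine (h3.congr_deriv ?_).hasDerivWithinAt
      simp) (fun τ hτ => hk τ (Ico_subset_Icc_self hτ))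
  refine le_of_eq_of_le (congrArg norm ?_) this
  simp only [one_smul, zero_smul, add_zero]
  ring

/-- A continuous function with continuous right derivative is differentiable. -/
lemma hasDerivAt_of_right {φ ψ : ℝ → ℝ} (hφ : Continuous φ) (hψ : Continuous ψ)
    (h : ∀ t, HasDerivWithinAt φ (ψ t) (Ici t) t) (t : ℝ) : HasDerivAt φ (ψ t) t := by
  have hP : ∀ y, HasDerivAt (fun y => φ (t - 1) + ∫ s in (t - 1)..y, ψ s) (ψ y) y := fun y =>
    (hψ.integral_hasStrictDerivAt (t - 1) y).hasDerivAt.const_add _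
  have heq : ∀ y ∈ Icc (t - 1) (t + 1), φ y = φ (t - 1) + ∫ s in (t - 1)..y, ψ s :=
    eq_of_has_deriv_right_eq (f' := ψ) (fun y _ => h y)
      (fun y _ => (hP y).hasDerivWithinAt) hφ.continuousOn
      (fun y _ => (hP y).continuousAt.continuousWithinAt) (by simp)
  refine (hP t).congr_of_eventuallyEq ?_
  filter_upwards [Icc_mem_nhds (show t - 1 < t by linarith) (show t < t + 1 by linarith)] with y hy
    using heq y hy

section TimeDerivative

variable {E : Type*} [NormedAddCommGroup E] [InnerProductSpace ℝ E] [FiniteDimensional ℝ E]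
  [MeasurableSpace E] [BorelSpace E]

/-- Short-time expansion `𝔼 φ (x + √(2τ) Z) = φ x + τ Δφ x + O(τ ^ (1 + α/2))`. -/
lemma norm_heat_sub_laplacian_le {ι : Type*} [Fintype ι] (e : OrthonormalBasis ι ℝ E)
    {U : E × ℝ → ℝ} {U' : E × ℝ → E →L[ℝ] ℝ} {U'' : E × ℝ → E →L[ℝ] E →L[ℝ] ℝ} {M A α : ℝ}
    (hα : 0 ≤ α) (hA0 : 0 ≤ A) (hU : Continuous U) (hM : ∀ X, ‖U X‖ ≤ M)
    (h1 : ∀ x t, HasFDerivAt (fun y => U (y, t)) (U' (x, t)) x)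
    (h2 : ∀ x t, HasFDerivAt (fun y => U' (y, t)) (U'' (x, t)) x)
    (hA : ∀ x y t, ‖U'' (x, t) - U'' (y, t)‖ ≤ A * ‖x - y‖ ^ α) {τ : ℝ} (hτ : 0 ≤ τ)
    (x : E) (t : ℝ) :
    ‖heat τ U (x, t + τ) - U (x, t) - τ * ∑ i, U'' (x, t) (e i) (e i)‖ ≤
      A * (2 * τ) ^ (1 + α / 2) * gaussMoment E (2 + α) := by
  set a := √(2 * τ) with ha
  have ha0 : 0 ≤ a := Real.sqrt_nonneg _
  have ha2 : a ^ 2 = 2 * τ := Real.sq_sqrt (by positivity)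
  obtain ⟨hBi, hB⟩ := integral_bilin_stdGaussian e (U'' (x, t))
  have hLi : Integrable (fun z : E => U' (x, t) z) (stdGaussian E) :=
    (U' (x, t)).integrable_comp IsGaussian.integrable_id
  have hL : ∫ z, U' (x, t) z ∂stdGaussian E = 0 := integral_strongDual_stdGaussian _
  have hGi := integrable_gaussKernel hU hM (x, t + τ) τ
  simp only [← ha, add_sub_cancel_right] at hGi
  have key : heat τ U (x, t + τ) - U (x, t) - τ * ∑ i, U'' (x, t) (e i) (e i) =
      ∫ z, (U (x + a • z, t) - U (x, t) - U' (x, t) (a • z) - U'' (x, t) (a • z) (a • z) / 2)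
        ∂stdGaussian E := by
    have h3 : ∀ z, U (x + a • z, t) - U (x, t) - U' (x, t) (a • z) -
        U'' (x, t) (a • z) (a • z) / 2 =
        U (x + a • z, t) - U (x, t) - a * U' (x, t) z - τ * U'' (x, t) z z := by
      intro z
      simp only [map_smul, _root_.smul_apply, smul_eq_mul]
      linear_combination (-(1 / 2) * U'' (x, t) z z) * ha2
    have i1 : Integrable (fun z => U (x + a • z, t) - U (x, t)) (stdGaussian E) :=
      hGi.sub (integrable_const _)
    have i2 : Integrable (fun z => U (x + a • z, t) - U (x, t) - a * U' (x, t) z)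
      (stdGaussian E) := i1.sub (hLi.const_mul a)
    simp_rw [h3]
    rw [integral_sub i2 (hBi.const_mul τ), integral_sub i1 (hLi.const_mul a),
      integral_sub hGi (integrable_const _), integral_const_mul, integral_const_mul, hL, hB]
    simp [heat, ← ha]
  rw [key, gaussMoment, ← integral_const_mul]
  refine norm_integral_le_of_norm_le
    ((integrable_norm_rpow_stdGaussian (by positivity)).const_mul _) (ae_of_all _ fun z => ?_)
  refine (norm_taylor_two_le hα hA0 (fun y => h1 y t) (fun y => h2 y t) x (a • z)
    fun y => hA y x t).trans_eq ?_
  rw [norm_smul, Real.norm_of_nonneg ha0, Real.mul_rpow ha0 (norm_nonneg z), ha,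
    Real.sqrt_eq_rpow, ← Real.rpow_mul (by positivity),
    show 1 / 2 * (2 + α) = 1 + α / 2 by ring]
  ring

/-- A function obeying Duhamel's formula with source `f` solves `∂ₜ U = f + Δ U`, as far as right
derivatives in time are concerned. -/
lemma hasDerivWithinAt_of_duhamel {ι : Type*} [Fintype ι] (e : OrthonormalBasis ι ℝ E)
    {f U : E × ℝ → ℝ} {U' : E × ℝ → E →L[ℝ] ℝ} {U'' : E × ℝ → E →L[ℝ] E →L[ℝ] ℝ} {M H M' A α : ℝ}
    (hα : 0 < α) (hA0 : 0 ≤ A) (hH0 : 0 ≤ H) (hf : Continuous f) (hM : ∀ X, ‖f X‖ ≤ M)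
    (hH : ∀ x y t, ‖f (x, t) - f (y, t)‖ ≤ H * ‖x - y‖ ^ α)
    (hU : Continuous U) (hM' : ∀ X, ‖U X‖ ≤ M')
    (h1 : ∀ x t, HasFDerivAt (fun y => U (y, t)) (U' (x, t)) x)
    (h2 : ∀ x t, HasFDerivAt (fun y => U' (y, t)) (U'' (x, t)) x)
    (hA : ∀ x y t, ‖U'' (x, t) - U'' (y, t)‖ ≤ A * ‖x - y‖ ^ α)
    (hD : ∀ τ, 0 ≤ τ → ∀ X, U X = (∫ s in Ioc 0 τ, heat s f X) + heat τ U X) (x : E) (t : ℝ) :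
    HasDerivWithinAt (fun t => U (x, t)) (f (x, t) + ∑ i, U'' (x, t) (e i) (e i)) (Ici t) t := by
  rw [hasDerivWithinAt_iff_isLittleO, Asymptotics.isLittleO_iff]
  intro c hc
  set κ := gaussMoment E (2 + α) with hκ
  set κ' := gaussMoment E α with hκ'
  have hκ0 : 0 ≤ κ' := gaussMoment_nonneg _ _
  have hsmall : ∀ (B p : ℝ), 0 < p → ∀ᶠ y in 𝓝 t, B * (2 * (y - t)) ^ p < c / 3 := by
    intro B p hp
    have hcont : ContinuousAt (fun y : ℝ => B * (2 * (y - t)) ^ p) t := by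
      refine ContinuousAt.mul continuousAt_const (ContinuousAt.rpow_const (by fun_prop) (Or.inr hp.le))
    refine hcont.eventually_lt continuousAt_const ?_
    simp only [sub_self, mul_zero, Real.zero_rpow hp.ne']
    positivity
  have hft : ∀ᶠ y in 𝓝 t, ‖f (x, y) - f (x, t)‖ < c / 3 := by
    have hcont : Continuous fun y => ‖f (x, y) - f (x, t)‖ := by fun_prop
    refine hcont.continuousAt.eventually_lt continuousAt_const ?_
    simp only [sub_self, norm_zero]
    positivity
  obtain ⟨δ, hδ, hfδ⟩ := Metric.eventually_nhds_iff.1 hft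
  filter_upwards [self_mem_nhdsWithin, nhdsWithin_le_nhds (Metric.ball_mem_nhds t hδ),
    nhdsWithin_le_nhds (hsmall (2 * A * κ) (α / 2) (by positivity)),
    nhdsWithin_le_nhds (hsmall (H * κ') (α / 2) (by positivity))] with y hy hyδ hy1 hy2
  set τ := y - t with hτ_def
  have hτ : 0 ≤ τ := sub_nonneg.2 hy
  have hyt : y = t + τ := by rw [hτ_def]; ring
  have e1 := norm_heat_sub_laplacian_le e hα.le hA0 hU hM' h1 h2 hA hτ x t
  have e2 : ‖(∫ s in Ioc 0 τ, heat s f (x, t + τ)) - τ * f (x, t)‖ ≤ (2 * c / 3) * τ := by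
    have hmeas : StronglyMeasurable fun s : ℝ => heat s f (x, t + τ) :=
      (stronglyMeasurable_heat (E := E) (Φ := fun _ => f)
        (hf.comp continuous_snd).stronglyMeasurable).comp_measurable
        (measurable_id.prodMk measurable_const)
    have hint : IntegrableOn (fun s : ℝ => heat s f (x, t + τ)) (Ioc 0 τ) :=
      Integrable.of_bound hmeas.aestronglyMeasurable M
        (ae_of_all _ fun s => norm_heat_le hM s _)
    have h3 : τ * f (x, t) = ∫ _ in Ioc 0 τ, f (x, t) := by simp [hτ]
    rw [h3, ← integral_sub hint (integrable_const _)]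
    have h4 := norm_setIntegral_le_of_norm_le_const (μ := volume) (s := Ioc 0 τ)
      (f := fun s => heat s f (x, t + τ) - f (x, t)) (C := 2 * c / 3) (by simp) fun s hs => by
        have h5 := norm_heat_sub_le hf hM hα.le hH s x (t + τ)
        have h6 : ‖f (x, t + τ - s) - f (x, t)‖ < c / 3 := by
          apply hfδ
          rw [mem_ball_iff_norm, Real.norm_eq_abs, ← hτ_def, abs_of_nonneg hτ] at hyδ
          rw [Real.dist_eq, abs_of_nonneg] <;> linarith [hs.1, hs.2]
        have h7 : H * √(2 * s) ^ α * κ' ≤ c / 3 := by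
          refine le_trans ?_ hy2.le
          rw [Real.sqrt_eq_rpow, ← Real.rpow_mul (by linarith [hs.1]),
            show 1 / 2 * α = α / 2 by ring]
          have h8 : (2 * s) ^ (α / 2) ≤ (2 * τ) ^ (α / 2) :=
            Real.rpow_le_rpow (by linarith [hs.1]) (by linarith [hs.2]) (by positivity)
          calc _ = H * κ' * (2 * s) ^ (α / 2) := by ring
            _ ≤ _ := by gcongr
        have h9 : heat s f (x, t + τ) - f (x, t) = (heat s f (x, t + τ) - f (x, t + τ - s)) +
          (f (x, t + τ - s) - f (x, t)) := by ring
        rw [h9]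
        refine (norm_add_le _ _).trans ?_
        linarith
    refine h4.trans_eq ?_
    simp [hτ]
  have e3 : A * (2 * τ) ^ (1 + α / 2) * κ ≤ c / 3 * τ := by
    rw [Real.rpow_add_of_nonneg (by positivity) zero_le_one (by positivity), Real.rpow_one]
    calc _ = 2 * A * κ * (2 * τ) ^ (α / 2) * τ := by ring
      _ ≤ _ := by gcongr
  have e4 := hD τ hτ (x, t + τ)
  rw [hyt, e4, smul_eq_mul, Real.norm_of_nonneg hτ]
  have e5 : (∫ s in Ioc 0 τ, heat s f (x, t + τ)) + heat τ U (x, t + τ) - U (x, t) -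
      τ * (f (x, t) + ∑ i, U'' (x, t) (e i) (e i)) =
      ((∫ s in Ioc 0 τ, heat s f (x, t + τ)) - τ * f (x, t)) +
      (heat τ U (x, t + τ) - U (x, t) - τ * ∑ i, U'' (x, t) (e i) (e i)) := by ring
  rw [e5]
  refine (norm_add_le _ _).trans ?_
  linarith

end TimeDerivative

/-! ### Existence for data with zero spatial mean -/

section Hessian

variable {E : Type*} [NormedAddCommGroup E] [InnerProductSpace ℝ E] [FiniteDimensional ℝ E]
  [MeasurableSpace E] [BorelSpace E] {f : E × ℝ → ℝ} {M α : ℝ}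

lemma stronglyMeasurable_uncurry_const (hf : Continuous f) :
    StronglyMeasurable (Function.uncurry fun _ : ℝ => f) :=
  (hf.comp continuous_snd).stronglyMeasurable

/-- The potential of the Hessians converges, and is Hölder continuous. -/
lemma isKernel_heatHess (hf : Continuous f) (hM : ∀ X, ‖f X‖ ≤ M) (hα : α ∈ Ioo (0 : ℝ) 1)
    {K q : ℝ} (hK0 : 0 ≤ K) (hq : q < -1)
    (hKq : DecayBound (fun s => heatHess s f) K (α / 2 - 1) q) :
    (∃ b, IsKernel (fun s => heatHess s f) b) ∧ ∃ A B, 0 ≤ A ∧ 0 ≤ B ∧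
      (∀ x y t, ‖potential (fun s => heatHess s f) (x, t) -
        potential (fun s => heatHess s f) (y, t)‖ ≤ A * ‖x - y‖ ^ α) ∧
      ∀ x t₁ t₂, t₁ ≤ t₂ → ‖potential (fun s => heatHess s f) (x, t₂) -
        potential (fun s => heatHess s f) (x, t₁)‖ ≤ B * (t₂ - t₁) ^ (α / 2) := by
  have hm : StronglyMeasurable (Function.uncurry fun s => heatHess s f) :=
    stronglyMeasurable_heatHess (Φ := fun _ => f) (stronglyMeasurable_uncurry_const hf)
  have k₂ := IsKernel.of_decayBound hm (fun s _ => continuous_heatHess hf hM s) hKq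
    (by linarith [hα.1]) hq
  have hK : ∀ s, 0 < s → ∀ X, ‖heatHess s f X‖ ≤ K * s ^ (α / 2 - 1) := fun s hs X =>
    (hKq s hs X).trans (mul_le_mul_of_nonneg_left (min_le_left _ _) hK0)
  obtain ⟨L, hL0, hL⟩ : ∃ L, 0 ≤ L ∧ ∀ s, 0 < s → ∀ x y t,
      ‖heatHess s f (x, t) - heatHess s f (y, t)‖ ≤ L * s ^ ((α - 3) / 2) * ‖x - y‖ := by
    refine ⟨gaussMoment E 1 * K * (1 / 2) ^ (-(1 / 2) + (α / 2 - 1)),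
      mul_nonneg (mul_nonneg (gaussMoment_nonneg _ _) hK0) (by positivity), fun s hs x y t => ?_⟩
    have h := lipschitz_heatHess hf hM hK hs x y t
    rwa [show s ^ (-(1 / 2) + (α / 2 - 1)) = s ^ ((α - 3) / 2) by congr 1; ring] at h
  have hsp := k₂.holder_space hα hK hL
  have h1α : 0 < 1 - α := by linarith [hα.2]
  have hα0 := hα.1
  have hA0 : 0 ≤ 2 * K / (α / 2) + L / ((1 - α) / 2) := by positivity
  refine ⟨⟨_, k₂⟩, _, _, hA0, ?_, hsp, fun x t₁ t₂ ht => k₂.holder_time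
    (fun τ hτ s hs => heat_heatHess hf hM hs hτ) hα0 hK hsp x ht⟩
  have := gaussMoment_nonneg E α
  positivity

end Hessian

section Existence

variable {n : ℕ}

lemma norm_sub_le_parabolicDist (X Y : EuclideanSpace ℝ (Fin n) × ℝ) :
    ‖X.1 - Y.1‖ ≤ parabolicDist X Y :=
  Real.le_sqrt_of_sq_le (le_add_of_nonneg_right (abs_nonneg _))

lemma abs_sub_rpow_le_parabolicDist {α : ℝ} (hα : 0 ≤ α) (X Y : EuclideanSpace ℝ (Fin n) × ℝ) :
    |X.2 - Y.2| ^ (α / 2) ≤ parabolicDist X Y ^ α := by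
  rw [show α / 2 = 1 / 2 * α by ring, Real.rpow_mul (abs_nonneg _), ← Real.sqrt_eq_rpow]
  exact Real.rpow_le_rpow (Real.sqrt_nonneg _)
    (Real.sqrt_le_sqrt (le_add_of_nonneg_left (sq_nonneg _))) hα

lemma parabolicDist_nonneg (X Y : EuclideanSpace ℝ (Fin n) × ℝ) : 0 ≤ parabolicDist X Y :=
  Real.sqrt_nonneg _

lemma parabolicDist_same_time (x y : EuclideanSpace ℝ (Fin n)) (t : ℝ) :
    parabolicDist (x, t) (y, t) = ‖x - y‖ := by
  simp [parabolicDist]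

/-- Separate Hölder continuity in space and in time gives parabolic Hölder continuity. -/
lemma holder_of_space_of_time {F : Type*} [NormedAddCommGroup F]
    {G : EuclideanSpace ℝ (Fin n) × ℝ → F} {A B α : ℝ} (hα : 0 ≤ α) (hA0 : 0 ≤ A) (hB0 : 0 ≤ B)
    (hA : ∀ x y t, ‖G (x, t) - G (y, t)‖ ≤ A * ‖x - y‖ ^ α)
    (hB : ∀ x t₁ t₂, t₁ ≤ t₂ → ‖G (x, t₂) - G (x, t₁)‖ ≤ B * (t₂ - t₁) ^ (α / 2))
    (X Y : EuclideanSpace ℝ (Fin n) × ℝ) :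
    ‖G X - G Y‖ ≤ (A + B) * parabolicDist X Y ^ α := by
  have h1 : ‖G X - G (Y.1, X.2)‖ ≤ A * parabolicDist X Y ^ α := by
    refine (hA X.1 Y.1 X.2).trans ?_
    gcongr
    exact norm_sub_le_parabolicDist X Y
  have h2 : ‖G (Y.1, X.2) - G Y‖ ≤ B * |X.2 - Y.2| ^ (α / 2) := by
    rcases le_total X.2 Y.2 with h | h
    · rw [norm_sub_rev, abs_sub_comm, abs_of_nonneg (sub_nonneg.2 h)]
      exact hB Y.1 X.2 Y.2 h
    · rw [abs_of_nonneg (sub_nonneg.2 h)]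
      exact hB Y.1 Y.2 X.2 h
  have h3 : B * |X.2 - Y.2| ^ (α / 2) ≤ B * parabolicDist X Y ^ α :=
    mul_le_mul_of_nonneg_left (abs_sub_rpow_le_parabolicDist hα X Y) hB0
  have h4 := norm_sub_le_norm_sub_add_norm_sub (G X) (G (Y.1, X.2)) (G Y)
  linarith

lemma isPeriodic_heat {f : EuclideanSpace ℝ (Fin n) × ℝ → ℝ} (hp : IsPeriodic f) (s : ℝ) :
    IsPeriodic (heat s f) := by
  refine ⟨isSpacePeriodic_heat hp.1 s, fun x t => ?_⟩
  simp only [heat]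
  congr 1
  ext z
  rw [add_sub_right_comm]
  exact hp.2 _ _

lemma isPeriodic_potential {Φ : ℝ → EuclideanSpace ℝ (Fin n) × ℝ → ℝ}
    (hp : ∀ s, IsPeriodic (Φ s)) : IsPeriodic (potential Φ) := by
  refine ⟨fun t i x => ?_, fun x t => ?_⟩
  · simp only [potential]
    congr 1
    ext s
    exact (hp s).1 t i x
  · simp only [potential]
    congr 1
    ext s
    exact (hp s).2 x t

variable {f : EuclideanSpace ℝ (Fin n) × ℝ → ℝ} {M H α : ℝ}

lemma IsZeroMean.isKernel_heat (hf : IsZeroMean f) (hM : ∀ X, ‖f X‖ ≤ M) :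
    ∃ b, IsKernel (fun s => TorusHeat.heat s f) b := by
  obtain ⟨K, -, hK⟩ := hf.decayBound_heat hM
  exact ⟨_, IsKernel.of_decayBound
    (stronglyMeasurable_heat (stronglyMeasurable_uncurry_const hf.continuous))
    (fun s _ => continuous_heat hf.continuous hM s) hK (by norm_num) (by norm_num)⟩

lemma IsZeroMean.isKernel_heatGrad (hf : IsZeroMean f) (hM : ∀ X, ‖f X‖ ≤ M)
    (hα : α ∈ Ioo (0 : ℝ) 1) (hH0 : 0 ≤ H)
    (hH : ∀ x y t, ‖f (x, t) - f (y, t)‖ ≤ H * ‖x - y‖ ^ α) :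
    ∃ b, IsKernel (fun s => heatGrad s f) b := by
  obtain ⟨K, -, hK⟩ := hf.decayBound_heatGrad hM hα hH0 hH
  exact ⟨_, IsKernel.of_decayBound
    (stronglyMeasurable_heatGrad (stronglyMeasurable_uncurry_const hf.continuous))
    (fun s _ => continuous_heatGrad hf.continuous hM s) hK (by linarith [hα.1]) (by norm_num)⟩

/-- For a source `f` with zero spatial means, the potential `∫₀^∞ heat s f ds` is a periodic
solution of `∂ₜ U - Δ U = f` with Hölder continuous Hessian. -/
lemma IsZeroMean.exists_solution (hf : IsZeroMean f) (hp : IsPeriodic f) (hM : ∀ X, ‖f X‖ ≤ M)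
    (hα : α ∈ Ioo (0 : ℝ) 1) (hH0 : 0 ≤ H)
    (hH : ∀ x y t, ‖f (x, t) - f (y, t)‖ ≤ H * ‖x - y‖ ^ α) :
    ∃ (U : EuclideanSpace ℝ (Fin n) × ℝ → ℝ)
      (U' : EuclideanSpace ℝ (Fin n) × ℝ → EuclideanSpace ℝ (Fin n) →L[ℝ] ℝ)
      (U'' : EuclideanSpace ℝ (Fin n) × ℝ →
        EuclideanSpace ℝ (Fin n) →L[ℝ] EuclideanSpace ℝ (Fin n) →L[ℝ] ℝ),
      Continuous U ∧ Continuous U' ∧ Continuous U'' ∧ IsPeriodic U ∧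
      (∀ x t, HasFDerivAt (fun y => U (y, t)) (U' (x, t)) x) ∧
      (∀ x t, HasFDerivAt (fun y => U' (y, t)) (U'' (x, t)) x) ∧
      (∃ C, ∀ X Y, ‖U'' X - U'' Y‖ ≤ C * parabolicDist X Y ^ α) ∧
      (∀ x t, HasDerivAt (fun t => U (x, t)) (f (x, t) + ∑ i, U'' (x, t)
        (EuclideanSpace.basisFun (Fin n) ℝ i) (EuclideanSpace.basisFun (Fin n) ℝ i)) t) := by
  have hα0 := hα.1
  have hfc := hf.continuous
  obtain ⟨b₀, k₀⟩ := hf.isKernel_heat hM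
  obtain ⟨b₁, k₁⟩ := hf.isKernel_heatGrad hM hα hH0 hH
  obtain ⟨K, hK0, hK⟩ := hf.decayBound_heatHess hM hα hH0 hH
  obtain ⟨⟨b₂, k₂⟩, A, B, hA0, hB0, hsp, hti⟩ :=
    isKernel_heatHess hfc hM hα hK0 (by norm_num) hK
  have d₁ := k₀.hasFDerivAt_potential k₁ fun s hs x t => hasFDerivAt_heat hs hfc hM x t
  have d₂ := k₁.hasFDerivAt_potential k₂ fun s hs x t => hasFDerivAt_heatGrad hfc hM hs x t
  have c₀ := k₀.continuous_potential
  have c₁ := k₁.continuous_potential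
  have c₂ := k₂.continuous_potential
  have hb := k₀.norm_potential_le
  have hD : ∀ τ, 0 ≤ τ → ∀ X, potential (fun s => TorusHeat.heat s f) X =
      (∫ s in Ioc 0 τ, TorusHeat.heat s f X) +
        TorusHeat.heat τ (potential fun s => TorusHeat.heat s f) X := fun τ hτ X =>
    k₀.potential_eq_add_heat hτ (fun s hs => by rw [heat_heat hfc hM hτ hs.le, add_comm]) X
  have hpU : IsPeriodic (potential fun s => TorusHeat.heat s f) :=
    isPeriodic_potential (isPeriodic_heat hp)
  generalize (potential fun s => TorusHeat.heat s f) = U at *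
  generalize (potential fun s => heatGrad s f) = U' at *
  generalize (potential fun s => heatHess s f) = U'' at *
  refine ⟨U, U', U'', c₀, c₁, c₂, hpU, d₁, d₂,
    ⟨_, holder_of_space_of_time (G := U'') hα0.le hA0 hB0 hsp hti⟩, fun x => ?_⟩
  refine hasDerivAt_of_right (by fun_prop) (by fun_prop) fun t => ?_
  exact hasDerivWithinAt_of_duhamel (EuclideanSpace.basisFun (Fin n) ℝ) hα0 hA0 hH0 hfc hM hH c₀
    hb d₁ d₂ hsp hD x t

end Existence

/-! ### Derivatives as tensors -/

section Tensor

variable {n : ℕ}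

/-- Bilinear maps as multilinear forms in two variables, isometrically. -/
def bilinToMultilinear (E : Type*) [NormedAddCommGroup E] [NormedSpace ℝ E] :
    (E →L[ℝ] E →L[ℝ] ℝ) ≃ₗᵢ[ℝ] ContinuousMultilinearMap ℝ (fun _ : Fin 2 => E) ℝ :=
  ((continuousMultilinearCurryFin0 ℝ E (E →L[ℝ] E →L[ℝ] ℝ)).symm.trans
    (continuousMultilinearCurryRightEquiv' ℝ 0 E (E →L[ℝ] ℝ)).symm).trans
    (continuousMultilinearCurryRightEquiv' ℝ 1 E ℝ).symm

lemma norm_bilinToMultilinear_sub {E : Type*} [NormedAddCommGroup E] [NormedSpace ℝ E]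
    (a b : E →L[ℝ] E →L[ℝ] ℝ) :
    ‖bilinToMultilinear E a - bilinToMultilinear E b‖ = ‖a - b‖ := by
  rw [← dist_eq_norm]
  exact ((bilinToMultilinear E).dist_map a b).trans (dist_eq_norm a b)

lemma iteratedFDeriv_one_eq {E : Type*} [NormedAddCommGroup E] [NormedSpace ℝ E] {φ : E → ℝ}
    {φ' : E → E →L[ℝ] ℝ} (h1 : ∀ y, HasFDerivAt φ (φ' y) y) (x : E) :
    iteratedFDeriv ℝ 1 φ x = (continuousMultilinearCurryFin1 ℝ E ℝ).symm (φ' x) := by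
  ext m
  simp [(h1 x).fderiv]

lemma iteratedFDeriv_two_eq {E : Type*} [NormedAddCommGroup E] [NormedSpace ℝ E] {φ : E → ℝ}
    {φ' : E → E →L[ℝ] ℝ} {φ'' : E → E →L[ℝ] E →L[ℝ] ℝ} (h1 : ∀ y, HasFDerivAt φ (φ' y) y)
    (h2 : ∀ y, HasFDerivAt φ' (φ'' y) y) (x : E) :
    iteratedFDeriv ℝ 2 φ x = bilinToMultilinear E (φ'' x) := by
  have e1 : fderiv ℝ φ = φ' := funext fun y => (h1 y).fderiv
  have e2 : fderiv ℝ φ' = φ'' := funext fun y => (h2 y).fderiv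
  rw [iteratedFDeriv_succ_eq_comp_right, e1, Function.comp_apply,
    iteratedFDeriv_succ_eq_comp_right, e2, Function.comp_apply, iteratedFDeriv_zero_eq_comp]
  rfl

lemma laplacian_eq_sum {φ : EuclideanSpace ℝ (Fin n) → ℝ}
    {φ' : EuclideanSpace ℝ (Fin n) → EuclideanSpace ℝ (Fin n) →L[ℝ] ℝ}
    {φ'' : EuclideanSpace ℝ (Fin n) →
      EuclideanSpace ℝ (Fin n) →L[ℝ] EuclideanSpace ℝ (Fin n) →L[ℝ] ℝ}
    (h1 : ∀ y, HasFDerivAt φ (φ' y) y) (h2 : ∀ y, HasFDerivAt φ' (φ'' y) y)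
    (x : EuclideanSpace ℝ (Fin n)) :
    Laplacian.laplacian φ x = ∑ i, φ'' x (EuclideanSpace.basisFun (Fin n) ℝ i)
      (EuclideanSpace.basisFun (Fin n) ℝ i) := by
  have e1 : fderiv ℝ φ = φ' := funext fun y => (h1 y).fderiv
  rw [InnerProductSpace.laplacian_eq_iteratedFDeriv_orthonormalBasis φ
    (EuclideanSpace.basisFun (Fin n) ℝ)]
  simp only [iteratedFDeriv_two_apply, e1, (h2 x).fderiv]
  simp

lemma timeDeriv_zero (u : EuclideanSpace ℝ (Fin n) × ℝ → ℝ) : timeDeriv 0 u = u := by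
  ext X
  simp [timeDeriv]

lemma mixedDeriv_zero_left (u : EuclideanSpace ℝ (Fin n) × ℝ → ℝ) (j : ℕ) :
    mixedDeriv 0 j u = fun X => (continuousMultilinearCurryFin0 ℝ (EuclideanSpace ℝ (Fin n))
      ℝ).symm (timeDeriv j u X) := by
  ext1 X
  simp only [mixedDeriv]
  rw [iteratedFDeriv_zero_eq_comp]
  rfl

/-- A function with continuous derivatives `∂ₓu`, `∂ₓ²u`, `∂ₜu`, the last two Hölder continuous, is
in `C^{2+α, 1+α/2}`. -/
lemma isParabolicHolder_one {u ut : EuclideanSpace ℝ (Fin n) × ℝ → ℝ}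
    {u' : EuclideanSpace ℝ (Fin n) × ℝ → EuclideanSpace ℝ (Fin n) →L[ℝ] ℝ}
    {u'' : EuclideanSpace ℝ (Fin n) × ℝ →
      EuclideanSpace ℝ (Fin n) →L[ℝ] EuclideanSpace ℝ (Fin n) →L[ℝ] ℝ} {α C C' : ℝ}
    (c₀ : Continuous u) (c₁ : Continuous u') (c₂ : Continuous u'') (ct : Continuous ut)
    (h1 : ∀ x t, HasFDerivAt (fun y => u (y, t)) (u' (x, t)) x)
    (h2 : ∀ x t, HasFDerivAt (fun y => u' (y, t)) (u'' (x, t)) x)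
    (ht : ∀ x t, HasDerivAt (fun s => u (x, s)) (ut (x, t)) t)
    (hC : ∀ X Y, ‖u'' X - u'' Y‖ ≤ C * parabolicDist X Y ^ α)
    (hC' : ∀ X Y, ‖ut X - ut Y‖ ≤ C' * parabolicDist X Y ^ α) : IsParabolicHolder 1 α u := by
  have e0 := timeDeriv_zero u
  have et : timeDeriv 1 u = ut := by ext X; simp [timeDeriv, (ht X.1 X.2).deriv]
  have m1 : mixedDeriv 1 0 u = fun X => (continuousMultilinearCurryFin1 ℝ
      (EuclideanSpace ℝ (Fin n)) ℝ).symm (u' X) := by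
    ext1 X
    simp only [mixedDeriv, e0]
    exact iteratedFDeriv_one_eq (fun y => h1 y X.2) X.1
  have m2 : mixedDeriv 2 0 u = fun X =>
      bilinToMultilinear (EuclideanSpace ℝ (Fin n)) (u'' X) := by
    ext1 X
    simp only [mixedDeriv, e0]
    exact iteratedFDeriv_two_eq (fun y => h1 y X.2) (fun y => h2 y X.2) X.1
  have cd1 : ∀ x, ContDiff ℝ 1 fun s => u (x, s) := by
    intro x
    rw [contDiff_one_iff_deriv]
    refine ⟨fun t => (ht x t).differentiableAt, ?_⟩
    rw [show deriv (fun s => u (x, s)) = fun t => ut (x, t) from funext fun t => (ht x t).deriv]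
    fun_prop
  have cd2 : ∀ t, ContDiff ℝ 2 fun y => u (y, t) := by
    intro t
    rw [show (2 : WithTop ℕ∞) = 1 + 1 by norm_num, contDiff_succ_iff_fderiv]
    refine ⟨fun x => (h1 x t).differentiableAt, by simp, ?_⟩
    rw [show fderiv ℝ (fun y => u (y, t)) = fun y => u' (y, t) from
      funext fun x => (h1 x t).fderiv, contDiff_one_iff_fderiv]
    refine ⟨fun x => (h2 x t).differentiableAt, ?_⟩
    rw [show fderiv ℝ (fun y => u' (y, t)) = fun y => u'' (y, t) from
      funext fun x => (h2 x t).fderiv]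
    fun_prop
  refine ⟨fun i j hij => ?_, fun i j hij => ?_⟩
  · have hcases : (i = 0 ∧ j = 0) ∨ (i = 1 ∧ j = 0) ∨ (i = 2 ∧ j = 0) ∨ (i = 0 ∧ j = 1) := by omega
    rcases hcases with ⟨rfl, rfl⟩ | ⟨rfl, rfl⟩ | ⟨rfl, rfl⟩ | ⟨rfl, rfl⟩
    · refine ⟨fun x => (cd1 x).of_le (by simp), fun t => ?_, ?_⟩
      · rw [e0]
        exact (cd2 t).of_le (by simp)
      · rw [mixedDeriv_zero_left, e0]
        exact (LinearIsometryEquiv.continuous _).comp c₀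
    · refine ⟨fun x => (cd1 x).of_le (by simp), fun t => ?_, ?_⟩
      · rw [e0]
        exact (cd2 t).of_le (by norm_num)
      · rw [m1]
        exact (LinearIsometryEquiv.continuous _).comp c₁
    · refine ⟨fun x => (cd1 x).of_le (by simp), fun t => ?_, ?_⟩
      · rw [e0]
        exact (cd2 t).of_le (by norm_num)
      · rw [m2]
        exact (bilinToMultilinear (EuclideanSpace ℝ (Fin n))).continuous.comp c₂
    · refine ⟨fun x => (cd1 x).of_le (by norm_num), fun t => ?_, ?_⟩
      · rw [et]
        simp only [Nat.cast_zero, contDiff_zero]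
        fun_prop
      · rw [mixedDeriv_zero_left, et]
        exact (LinearIsometryEquiv.continuous _).comp ct
  · have hcases : (i = 2 ∧ j = 0) ∨ (i = 0 ∧ j = 1) := by omega
    rcases hcases with ⟨rfl, rfl⟩ | ⟨rfl, rfl⟩
    · refine ⟨C, fun X Y => ?_⟩
      rw [m2, norm_bilinToMultilinear_sub]
      exact hC X Y
    · refine ⟨C', fun X Y => ?_⟩
      rw [mixedDeriv_zero_left, et]
      simp only
      rw [← map_sub, LinearIsometryEquiv.norm_map]
      exact hC' X Y

end Tensor

/-! ### Existence -/

section Main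

variable {n : ℕ}

lemma IsParabolicHolder.continuous_and_holder {h : EuclideanSpace ℝ (Fin n) × ℝ → ℝ} {α : ℝ}
    (hh : IsParabolicHolder 0 α h) :
    Continuous h ∧ ∃ H, 0 ≤ H ∧ ∀ X Y, ‖h X - h Y‖ ≤ H * parabolicDist X Y ^ α := by
  constructor
  · have h1 := (hh.1 0 0 (by simp)).2.2
    rw [mixedDeriv_zero_left, timeDeriv_zero] at h1
    exact (LinearIsometryEquiv.comp_continuous_iff _).1 h1
  · obtain ⟨C, hC⟩ := hh.2 0 0 (by simp)
    refine ⟨|C|, abs_nonneg C, fun X Y => ?_⟩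
    have h1 := hC X Y
    rw [mixedDeriv_zero_left, timeDeriv_zero] at h1
    simp only at h1
    rw [← map_sub, LinearIsometryEquiv.norm_map] at h1
    refine h1.trans (mul_le_mul_of_nonneg_right (le_abs_self C) ?_)
    exact Real.rpow_nonneg (parabolicDist_nonneg X Y) α

/-- The source is split as `h = f + m`, `m t` being the spatial mean of `h` at time `t`; the
function of time `m` has zero mean over a period, hence a periodic primitive. -/
lemma exists_solution (hn : 1 ≤ n) {α : ℝ} (hα : α ∈ Ioo (0 : ℝ) 1)
    {h : EuclideanSpace ℝ (Fin n) × ℝ → ℝ} (hh : IsTorusParabolicHolder 0 α h) :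
    ∃ u : EuclideanSpace ℝ (Fin n) × ℝ → ℝ, IsTorusParabolicHolder 1 α u ∧
      ∀ (x : EuclideanSpace ℝ (Fin n)) (t : ℝ), deriv (fun s : ℝ => u (x, s)) t -
        Laplacian.laplacian (fun y : EuclideanSpace ℝ (Fin n) => u (y, t)) x = h (x, t) := by
  obtain ⟨hH, hmean, hper⟩ := hh
  obtain ⟨hc, H, hH0, hH⟩ := IsParabolicHolder.continuous_and_holder hH
  rw [isSpaceTimePeriodic_iff hn] at hper
  obtain ⟨M, hM⟩ := hper.exists_bound hc
  let m : ℝ → ℝ := fun t => ∫ x in spaceCube n, h (x, t)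
  have hmc : Continuous m := by
    refine continuous_of_dominated (bound := fun _ => M)
      (fun t => Continuous.aestronglyMeasurable (by fun_prop))
      (fun t => ae_of_all _ fun x => hM _) (integrable_const _) (ae_of_all _ fun x => by fun_prop)
  have hmb : ∀ t, ‖m t‖ ≤ M := fun t => by
    simpa using norm_integral_le_of_norm_le_const (μ := volume.restrict (spaceCube n))
      (ae_of_all _ fun x => hM (x, t))
  have hmp : Function.Periodic m 1 := fun t => by
    simp only [m]
    congr 1
    ext x
    exact hper.2 x t
  have hm0 : ∫ t in (0 : ℝ)..1, m t = 0 := by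
    rw [setIntegral_unitCube hc] at hmean
    exact hmean
  let f : EuclideanSpace ℝ (Fin n) × ℝ → ℝ := fun X => h X - m X.2
  have hfz : IsZeroMean f := by
    refine ⟨by fun_prop, fun t i x => ?_, fun t => ?_⟩
    · have := hper.1 t i x
      simp only [f] at this ⊢
      rw [this]
    · simp only [f]
      rw [integral_sub _ (integrable_const _)]
      · simp [m]
      · exact Integrable.of_bound (C := M) (Continuous.aestronglyMeasurable (by fun_prop))
          (ae_of_all _ fun x => hM _)
  have hfp : IsPeriodic f := by
    refine ⟨hfz.periodic, fun x t => ?_⟩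
    have h1 := hper.2 x t
    simp only [f] at h1 ⊢
    rw [h1, hmp t]
  have hfb : ∀ X, ‖f X‖ ≤ M + M := fun X =>
    (norm_sub_le _ _).trans (add_le_add (hM X) (hmb X.2))
  have hfH : ∀ x y t, ‖f (x, t) - f (y, t)‖ ≤ H * ‖x - y‖ ^ α := fun x y t => by
    rw [← parabolicDist_same_time x y t]
    simpa [f] using hH (x, t) (y, t)
  obtain ⟨U, U', U'', c₀, c₁, c₂, hUp, d₁, d₂, ⟨C, hC⟩, dt⟩ :=
    hfz.exists_solution hfp hfb hα hH0 hfH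
  let V : ℝ → ℝ := fun t => ∫ s in (0 : ℝ)..t, m s
  have hV : ∀ t, HasDerivAt V (m t) t := fun t => (hmc.integral_hasStrictDerivAt 0 t).hasDerivAt
  have hVc : Continuous V := continuous_iff_continuousAt.2 fun t => (hV t).continuousAt
  have hVp : Function.Periodic V 1 := fun t => by
    simp only [V]
    have h1 := hmp.intervalIntegral_add_eq t 0
    rw [zero_add, hm0] at h1
    rw [← intervalIntegral.integral_add_adjacent_intervals (hmc.intervalIntegrable 0 t)
      (hmc.intervalIntegrable t (t + 1)), h1, add_zero]
  let c : ℝ := ∫ X in unitCube n, (U X + V X.2)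
  let u : EuclideanSpace ℝ (Fin n) × ℝ → ℝ := fun X => U X + V X.2 - c
  let ut : EuclideanSpace ℝ (Fin n) × ℝ → ℝ := fun X => h X + ∑ i, U'' X
    (EuclideanSpace.basisFun (Fin n) ℝ i) (EuclideanSpace.basisFun (Fin n) ℝ i)
  have huc : Continuous u := by fun_prop
  have hutc : Continuous ut := by fun_prop
  have e₁ : ∀ x t, HasFDerivAt (fun y => u (y, t)) (U' (x, t)) x := fun x t =>
    ((d₁ x t).add_const (V t)).sub_const c
  have et : ∀ x t, HasDerivAt (fun s => u (x, s)) (ut (x, t)) t := fun x t => by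
    refine (((dt x t).add (hV t)).sub_const c).congr_deriv ?_
    simp only [f, ut]
    ring
  have hut : ∀ X Y, ‖ut X - ut Y‖ ≤ (H + n * C) * parabolicDist X Y ^ α := by
    intro X Y
    have h1 : ∀ i, ‖U'' X (EuclideanSpace.basisFun (Fin n) ℝ i)
        (EuclideanSpace.basisFun (Fin n) ℝ i) - U'' Y (EuclideanSpace.basisFun (Fin n) ℝ i)
        (EuclideanSpace.basisFun (Fin n) ℝ i)‖ ≤ C * parabolicDist X Y ^ α := fun i => by
      refine le_trans ?_ (hC X Y)
      have := (U'' X - U'' Y).le_opNorm₂ (EuclideanSpace.basisFun (Fin n) ℝ i)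
        (EuclideanSpace.basisFun (Fin n) ℝ i)
      simpa using this
    have h2 : ut X - ut Y = (h X - h Y) + ∑ i, (U'' X (EuclideanSpace.basisFun (Fin n) ℝ i)
        (EuclideanSpace.basisFun (Fin n) ℝ i) - U'' Y (EuclideanSpace.basisFun (Fin n) ℝ i)
        (EuclideanSpace.basisFun (Fin n) ℝ i)) := by
      simp only [ut, Finset.sum_sub_distrib]
      ring
    rw [h2]
    refine (norm_add_le _ _).trans ?_
    have h3 := norm_sum_le_of_le Finset.univ fun i _ => h1 i
    have h4 := hH X Y
    simp only [Finset.sum_const, Finset.card_univ, Fintype.card_fin, nsmul_eq_mul] at h3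
    calc _ ≤ H * parabolicDist X Y ^ α + n * (C * parabolicDist X Y ^ α) := add_le_add h4 h3
      _ = _ := by ring
  refine ⟨u, ⟨isParabolicHolder_one huc c₁ c₂ hutc e₁ d₂ et hC hut, ?_, ?_⟩, fun x t => ?_⟩
  · simp only [u]
    rw [integral_sub _ (integrable_const _)]
    · simp [c]
    · exact ContinuousOn.integrableOn_compact isCompact_unitCube
        (Continuous.continuousOn (by fun_prop))
  · rw [isSpaceTimePeriodic_iff hn]
    refine ⟨fun t i x => ?_, fun x t => ?_⟩
    · have h1 := hUp.1 t i x
      simp only [u] at h1 ⊢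
      rw [h1]
    · have h1 := hUp.2 x t
      simp only [u] at h1 ⊢
      rw [h1, hVp t]
  · rw [(et x t).deriv, laplacian_eq_sum (fun y => e₁ y t) (fun y => d₂ y t)]
    simp [ut]

end Main

/-! ### Uniqueness -/

section Uniqueness

variable {n : ℕ}

/-- The integral over a period of a directional derivative of a periodic function vanishes. -/
lemma IsPeriodic.setIntegral_deriv_eq_zero {g g' : EuclideanSpace ℝ (Fin n) × ℝ → ℝ}
    (hp : IsPeriodic g) (hg : Continuous g) (hg' : Continuous g')
    (V : EuclideanSpace ℝ (Fin n) × ℝ)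
    (hd : ∀ X (τ : ℝ), HasDerivAt (fun τ : ℝ => g (X + τ • V)) (g' (X + τ • V)) τ) :
    ∫ X in unitCube n, g' X = 0 := by
  have hcomp : IsCompact (Icc (-1 : ℝ) 1 ×ˢ unitCube n) := isCompact_Icc.prod isCompact_unitCube
  obtain ⟨B, hB⟩ := hcomp.exists_bound_of_continuousOn
    (f := fun q : ℝ × EuclideanSpace ℝ (Fin n) × ℝ => g' (q.2 + q.1 • V))
    (Continuous.continuousOn (by fun_prop))
  have h1 := (hasDerivAt_integral_of_dominated_loc_of_deriv_le (𝕜 := ℝ)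
    (μ := volume.restrict (unitCube n)) (x₀ := (0 : ℝ)) (s := Icc (-1) 1)
    (F := fun τ X => g (X + τ • V)) (F' := fun τ X => g' (X + τ • V)) (bound := fun _ => B)
    (Icc_mem_nhds (by norm_num) (by norm_num))
    (Eventually.of_forall fun τ => Continuous.aestronglyMeasurable (by fun_prop))
    (ContinuousOn.integrableOn_compact isCompact_unitCube (Continuous.continuousOn (by fun_prop)))
    (Continuous.aestronglyMeasurable (by fun_prop))
    ((ae_restrict_iff' isCompact_unitCube.isClosed.measurableSet).2
      (ae_of_all _ fun X hX τ hτ => hB (τ, X) ⟨hτ, hX⟩))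
    (integrable_const _) (ae_of_all _ fun X τ _ => hd X τ)).2
  simp_rw [hp.setIntegral_add hg] at h1
  have h2 := h1.unique (hasDerivAt_const (0 : ℝ) _)
  simpa using h2

lemma IsPeriodic.eq_zero_of_setIntegral_eq_zero {q : EuclideanSpace ℝ (Fin n) × ℝ → ℝ}
    (hp : IsPeriodic q) (hq : Continuous q) (h0 : ∀ X, 0 ≤ q X)
    (hi : ∫ X in unitCube n, q X = 0) (X : EuclideanSpace ℝ (Fin n) × ℝ) : q X = 0 := by
  -- after a translation, `X` is the centre of the cube
  let c : EuclideanSpace ℝ (Fin n) × ℝ := (WithLp.toLp 2 fun _ => 1 / 2, 1 / 2)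
  let p : EuclideanSpace ℝ (Fin n) × ℝ → ℝ := fun Y => q (Y + (X - c))
  have hpc : Continuous p := by fun_prop
  have hp0 : ∫ Y in unitCube n, p Y = 0 := by
    rw [← hi]
    exact hp.setIntegral_add hq (X - c)
  rw [setIntegral_eq_zero_iff_of_nonneg_ae (ae_of_all _ fun Y => h0 _)
    (hpc.continuousOn.integrableOn_compact isCompact_unitCube)] at hp0
  let O : Set (EuclideanSpace ℝ (Fin n) × ℝ) :=
    {Y | (∀ i, Y.1 i ∈ Ioo (0 : ℝ) 1) ∧ Y.2 ∈ Ioo (0 : ℝ) 1}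
  have hO : IsOpen O := by
    have : O = (⋂ i, (fun Y : EuclideanSpace ℝ (Fin n) × ℝ => Y.1 i) ⁻¹' Ioo (0 : ℝ) 1) ∩
        Prod.snd ⁻¹' Ioo (0 : ℝ) 1 := by
      ext Y
      simp [O]
    rw [this]
    exact (isOpen_iInter_of_finite fun i => isOpen_Ioo.preimage (by fun_prop)).inter
      (isOpen_Ioo.preimage continuous_snd)
  have hOs : O ⊆ unitCube n := fun Y hY =>
    ⟨fun i => Ioo_subset_Icc_self (hY.1 i), Ioo_subset_Icc_self hY.2⟩
  have h1 : p =ᵐ[volume.restrict O] 0 := ae_restrict_of_ae_restrict_of_subset hOs hp0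
  have h2 := Measure.eqOn_open_of_ae_eq h1 hO hpc.continuousOn continuousOn_const
  have hc : c ∈ O := by
    refine ⟨fun i => ?_, ?_⟩ <;> simp only [c] <;> norm_num
  have h3 := h2 hc
  simpa [p] using h3

/-- The derivatives of a function in `C^{2,1}`, as honest Fréchet derivatives. -/
lemma IsParabolicC.exists_derivs {u : EuclideanSpace ℝ (Fin n) × ℝ → ℝ} (hu : IsParabolicC 1 u) :
    ∃ (ut : EuclideanSpace ℝ (Fin n) × ℝ → ℝ)
      (u' : EuclideanSpace ℝ (Fin n) × ℝ → EuclideanSpace ℝ (Fin n) →L[ℝ] ℝ)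
      (u'' : EuclideanSpace ℝ (Fin n) × ℝ →
        EuclideanSpace ℝ (Fin n) →L[ℝ] EuclideanSpace ℝ (Fin n) →L[ℝ] ℝ),
      Continuous u ∧ Continuous ut ∧ Continuous u' ∧ Continuous u'' ∧
      (∀ x t, HasDerivAt (fun s => u (x, s)) (ut (x, t)) t) ∧
      (∀ x t, HasFDerivAt (fun y => u (y, t)) (u' (x, t)) x) ∧
      (∀ x t, HasFDerivAt (fun y => u' (y, t)) (u'' (x, t)) x) := by
  obtain ⟨-, -, m00⟩ := hu 0 0 (by norm_num)
  obtain ⟨-, -, m10⟩ := hu 1 0 (by norm_num)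
  obtain ⟨-, cx, m20⟩ := hu 2 0 (by norm_num)
  obtain ⟨ct, -, m01⟩ := hu 0 1 (by norm_num)
  simp only [timeDeriv_zero] at cx
  rw [mixedDeriv_zero_left] at m00 m01
  rw [timeDeriv_zero] at m00
  have c0 : Continuous u := (LinearIsometryEquiv.comp_continuous_iff _).1 m00
  have c1 : Continuous (timeDeriv 1 u) := (LinearIsometryEquiv.comp_continuous_iff _).1 m01
  have h1 : ∀ x t, HasFDerivAt (fun y => u (y, t)) (fderiv ℝ (fun y => u (y, t)) x) x := fun x t =>
    ((cx t).differentiable (by norm_num) x).hasFDerivAt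
  have h2 : ∀ x t, HasFDerivAt (fderiv ℝ fun y => u (y, t))
      (fderiv ℝ (fderiv ℝ fun y => u (y, t)) x) x := fun x t =>
    (((cx t).fderiv_right (m := 1) (by norm_num)).differentiable (by norm_num) x).hasFDerivAt
  have e1 : mixedDeriv 1 0 u = fun X => (continuousMultilinearCurryFin1 ℝ
      (EuclideanSpace ℝ (Fin n)) ℝ).symm (fderiv ℝ (fun y => u (y, X.2)) X.1) := by
    ext1 X
    simp only [mixedDeriv, timeDeriv_zero]
    exact iteratedFDeriv_one_eq (fun y => h1 y X.2) X.1
  have e2 : mixedDeriv 2 0 u = fun X => bilinToMultilinear (EuclideanSpace ℝ (Fin n))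
      (fderiv ℝ (fderiv ℝ fun y => u (y, X.2)) X.1) := by
    ext1 X
    simp only [mixedDeriv, timeDeriv_zero]
    exact iteratedFDeriv_two_eq (fun y => h1 y X.2) (fun y => h2 y X.2) X.1
  rw [e1] at m10
  rw [e2] at m20
  refine ⟨timeDeriv 1 u, fun X => fderiv ℝ (fun y => u (y, X.2)) X.1,
    fun X => fderiv ℝ (fderiv ℝ fun y => u (y, X.2)) X.1, c0, c1,
    (LinearIsometryEquiv.comp_continuous_iff _).1 m10,
    ((bilinToMultilinear (EuclideanSpace ℝ (Fin n))).comp_continuous_iff).1 m20, fun x t => ?_,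
    h1, h2⟩
  have := ((ct x).differentiable (by norm_num) t).hasDerivAt
  simpa [timeDeriv] using this

/-- The energy argument: multiply the heat equation by `w` and integrate over a period, so that
`∫ |∇w|² = -∫ w ∂ₜw = -½ ∫ ∂ₜ(w²) = 0`. -/
lemma eq_zero_of_heat_equation {w wt : EuclideanSpace ℝ (Fin n) × ℝ → ℝ}
    {w' : EuclideanSpace ℝ (Fin n) × ℝ → EuclideanSpace ℝ (Fin n) →L[ℝ] ℝ}
    {w'' : EuclideanSpace ℝ (Fin n) × ℝ →
      EuclideanSpace ℝ (Fin n) →L[ℝ] EuclideanSpace ℝ (Fin n) →L[ℝ] ℝ}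
    (hp : IsPeriodic w) (c₀ : Continuous w) (ct : Continuous wt) (c₁ : Continuous w')
    (c₂ : Continuous w'') (ht : ∀ x t, HasDerivAt (fun s => w (x, s)) (wt (x, t)) t)
    (h1 : ∀ x t, HasFDerivAt (fun y => w (y, t)) (w' (x, t)) x)
    (h2 : ∀ x t, HasFDerivAt (fun y => w' (y, t)) (w'' (x, t)) x)
    (heq : ∀ X, wt X = ∑ i, w'' X (EuclideanSpace.basisFun (Fin n) ℝ i)
      (EuclideanSpace.basisFun (Fin n) ℝ i))
    (h0 : ∫ X in unitCube n, w X = 0) : w = 0 := by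
  set e := EuclideanSpace.basisFun (Fin n) ℝ with he
  have hp' : IsPeriodic w' := by
    refine ⟨fun t i x => ?_, fun x t => ?_⟩
    · have h3 : HasFDerivAt (fun y => w (y + EuclideanSpace.single i 1, t))
          (w' (x + EuclideanSpace.single i 1, t)) x :=
        hasFDerivAt_comp_add_right _ |>.2 (h1 (x + EuclideanSpace.single i 1) t)
      have h4 : (fun y => w (y + EuclideanSpace.single i 1, t)) = fun y => w (y, t) :=
        funext fun y => hp.1 t i y
      rw [h4] at h3
      exact h3.unique (h1 x t)
    · have h4 : (fun y => w (y, t + 1)) = fun y => w (y, t) := funext fun y => hp.2 y t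
      have h3 := h1 x (t + 1)
      rw [h4] at h3
      exact h3.unique (h1 x t)
  have hI : ∀ {g : EuclideanSpace ℝ (Fin n) × ℝ → ℝ}, Continuous g →
      IntegrableOn g (unitCube n) := fun hg =>
    hg.continuousOn.integrableOn_compact isCompact_unitCube
  have it : ∫ X in unitCube n, 2 * (w X * wt X) = 0 := by
    refine IsPeriodic.setIntegral_deriv_eq_zero (g := fun X => w X ^ 2) ?_ (by fun_prop)
      (by fun_prop) (0, 1) fun X τ => ?_
    · refine ⟨fun t i x => ?_, fun x t => ?_⟩
      · have := hp.1 t i x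
        simp only at this ⊢
        rw [this]
      · have := hp.2 x t
        simp only at this ⊢
        rw [this]
    · have h3 : ∀ τ : ℝ, X + τ • ((0, 1) : EuclideanSpace ℝ (Fin n) × ℝ) = (X.1, X.2 + τ) :=
        fun τ => by ext1 <;> simp
      simp only [h3]
      have h4 := ((ht X.1 (X.2 + τ)).comp_const_add X.2 τ).pow 2
      refine h4.congr_deriv ?_
      simp
      ring
  have ix : ∀ i, ∫ X in unitCube n, (w' X (e i) ^ 2 + w X * w'' X (e i) (e i)) = 0 := by
    intro i
    refine IsPeriodic.setIntegral_deriv_eq_zero (g := fun X => w X * w' X (e i)) ?_ (by fun_prop)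
      (by fun_prop) (e i, 0) fun X τ => ?_
    · refine ⟨fun t j x => ?_, fun x t => ?_⟩
      · have := hp.1 t j x
        have h3 := hp'.1 t j x
        simp only at this h3 ⊢
        rw [this, h3]
      · have := hp.2 x t
        have h3 := hp'.2 x t
        simp only at this h3 ⊢
        rw [this, h3]
    · have h3 : ∀ τ : ℝ, X + τ • ((e i, 0) : EuclideanSpace ℝ (Fin n) × ℝ) =
          (X.1 + τ • e i, X.2) := fun τ => by ext1 <;> simp
      simp only [h3]
      have hl : HasDerivAt (fun τ : ℝ => X.1 + τ • e i) (e i) τ := by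
        simpa using ((hasDerivAt_id τ).smul_const (e i)).const_add X.1
      have h4 : HasDerivAt (fun τ : ℝ => w (X.1 + τ • e i, X.2)) (w' (X.1 + τ • e i, X.2) (e i)) τ :=
        HasFDerivAt.comp_hasDerivAt τ (h1 _ X.2) hl
      have h5 : HasDerivAt (fun τ : ℝ => w' (X.1 + τ • e i, X.2))
          (w'' (X.1 + τ • e i, X.2) (e i)) τ :=
        HasFDerivAt.comp_hasDerivAt τ (h2 _ X.2) hl
      have h6 : HasDerivAt (fun τ : ℝ => w' (X.1 + τ • e i, X.2) (e i))
          (w'' (X.1 + τ • e i, X.2) (e i) (e i)) τ :=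
        (ContinuousLinearMap.apply ℝ ℝ (e i)).hasFDerivAt.comp_hasDerivAt τ h5
      refine (h4.mul h6).congr_deriv ?_
      ring
  have hgrad : ∫ X in unitCube n, ∑ i, w' X (e i) ^ 2 = 0 := by
    have h3 : ∀ X, ∑ i, w' X (e i) ^ 2 =
        ∑ i, (w' X (e i) ^ 2 + w X * w'' X (e i) (e i)) - 1 / 2 * (2 * (w X * wt X)) := by
      intro X
      rw [Finset.sum_add_distrib, ← Finset.mul_sum, ← heq]
      ring
    simp_rw [h3]
    rw [integral_sub (hI (by fun_prop)) (hI (by fun_prop)), integral_const_mul, it,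
      integral_finsetSum _ fun i _ => hI (by fun_prop)]
    simp [ix]
  have hz : ∀ X, ∑ i, w' X (e i) ^ 2 = 0 := by
    refine IsPeriodic.eq_zero_of_setIntegral_eq_zero ⟨fun t j x => ?_, fun x t => ?_⟩ (by fun_prop)
      (fun X => Finset.sum_nonneg fun i _ => sq_nonneg _) hgrad
    · have h3 := hp'.1 t j x
      simp only at h3 ⊢
      rw [h3]
    · have h3 := hp'.2 x t
      simp only at h3 ⊢
      rw [h3]
  have hw' : ∀ X, w' X = 0 := by
    intro X
    have h3 := (Finset.sum_eq_zero_iff_of_nonneg fun i _ => sq_nonneg (w' X (e i))).1 (hz X)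
    refine ContinuousLinearMap.coe_injective (e.toBasis.ext fun i => ?_)
    simpa using h3 i (Finset.mem_univ i)
  have hw'' : ∀ X, w'' X = 0 := by
    intro X
    have h3 := h2 X.1 X.2
    simp only [hw'] at h3
    exact h3.unique (hasFDerivAt_const _ _)
  have hwt : ∀ X, wt X = 0 := fun X => by simp [heq, hw'']
  have hconst : ∀ X, w X = w 0 := by
    intro X
    have h3 : w (X.1, X.2) = w (0, X.2) := is_const_of_fderiv_eq_zero (𝕜 := ℝ)
      (f := fun y => w (y, X.2)) (fun y => (h1 y X.2).differentiableAt)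
      (fun y => by rw [(h1 y X.2).fderiv, hw']) X.1 0
    have h4 : w (0, X.2) = w (0, 0) := is_const_of_deriv_eq_zero
      (f := fun s => w (0, s)) (fun s => (ht 0 s).differentiableAt)
      (fun s => by rw [(ht 0 s).deriv, hwt]) X.2 0
    exact h3.trans h4
  ext X
  simp_rw [hconst] at h0
  rw [hconst X]
  simpa using h0

lemma continuous_pi_sub {T F : Type*} [TopologicalSpace T] [NormedAddCommGroup F] {a b : T → F}
    (ha : Continuous a) (hb : Continuous b) : Continuous (a - b) := ha.sub hb

lemma solution_unique (hn : 1 ≤ n) {α : ℝ} {u v h : EuclideanSpace ℝ (Fin n) × ℝ → ℝ}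
    (hu : IsTorusParabolicHolder 1 α u) (hv : IsTorusParabolicHolder 1 α v)
    (hue : ∀ (x : EuclideanSpace ℝ (Fin n)) (t : ℝ), deriv (fun s : ℝ => u (x, s)) t -
      Laplacian.laplacian (fun y : EuclideanSpace ℝ (Fin n) => u (y, t)) x = h (x, t))
    (hve : ∀ (x : EuclideanSpace ℝ (Fin n)) (t : ℝ), deriv (fun s : ℝ => v (x, s)) t -
      Laplacian.laplacian (fun y : EuclideanSpace ℝ (Fin n) => v (y, t)) x = h (x, t)) :
    u = v := by
  obtain ⟨hu1, hu0, hup⟩ := hu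
  obtain ⟨hv1, hv0, hvp⟩ := hv
  rw [isSpaceTimePeriodic_iff hn] at hup hvp
  obtain ⟨ut, u', u'', uc, utc, uc1, uc2, hut, hu', hu''⟩ := IsParabolicC.exists_derivs hu1.1
  obtain ⟨vt, v', v'', vc, vtc, vc1, vc2, hvt, hv', hv''⟩ := IsParabolicC.exists_derivs hv1.1
  rw [← sub_eq_zero]
  refine eq_zero_of_heat_equation (w := u - v) (wt := ut - vt) (w' := u' - v') (w'' := u'' - v'')
    ⟨fun t i x => ?_, fun x t => ?_⟩ (uc.sub vc) (utc.sub vtc) (uc1.sub vc1) (continuous_pi_sub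
      (F := EuclideanSpace ℝ (Fin n) →L[ℝ] EuclideanSpace ℝ (Fin n) →L[ℝ] ℝ) uc2 vc2)
    (fun x t => (hut x t).sub (hvt x t)) (fun x t => (hu' x t).sub (hv' x t))
    (fun x t => (hu'' x t).sub (hv'' x t)) (fun X => ?_) ?_
  · have h1 := hup.1 t i x
    have h2 := hvp.1 t i x
    simp only [Pi.sub_apply] at h1 h2 ⊢
    rw [h1, h2]
  · have h1 := hup.2 x t
    have h2 := hvp.2 x t
    simp only [Pi.sub_apply] at h1 h2 ⊢
    rw [h1, h2]
  · have h1 := hue X.1 X.2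
    have h2 := hve X.1 X.2
    rw [(hut X.1 X.2).deriv, laplacian_eq_sum (fun y => hu' y X.2) (fun y => hu'' y X.2)] at h1
    rw [(hvt X.1 X.2).deriv, laplacian_eq_sum (fun y => hv' y X.2) (fun y => hv'' y X.2)] at h2
    simp only [Pi.sub_apply, _root_.sub_apply, Finset.sum_sub_distrib]
    linarith
  · have h1 : IntegrableOn u (unitCube n) :=
      uc.continuousOn.integrableOn_compact isCompact_unitCube
    have h2 : IntegrableOn v (unitCube n) :=
      vc.continuousOn.integrableOn_compact isCompact_unitCube
    simp only [Pi.sub_apply]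
    rw [integral_sub h1 h2, hu0, hv0, sub_zero]

end Uniqueness

end

end TorusHeat

theorem proposition3p1 (n : ℕ) (hn : 1 ≤ n) (α : ℝ) (hα : α ∈ Set.Ioo (0 : ℝ) 1)
    (h : EuclideanSpace ℝ (Fin n) × ℝ → ℝ) (hh : IsTorusParabolicHolder 0 α h) :
    ∃! u : EuclideanSpace ℝ (Fin n) × ℝ → ℝ,
      IsTorusParabolicHolder 1 α u ∧
        ∀ (x : EuclideanSpace ℝ (Fin n)) (t : ℝ),
          deriv (fun s : ℝ => u (x, s)) t
            - Laplacian.laplacian (fun y : EuclideanSpace ℝ (Fin n) => u (y, t)) x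
            = h (x, t) := by
  obtain ⟨u, hu, hue⟩ := TorusHeat.exists_solution hn hα hh
  exact ⟨u, ⟨hu, hue⟩, fun v hv => TorusHeat.solution_unique hn hv.1 hu hv.2 hue⟩
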